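/- Let $X$ be a path-connected CW complex with base point $x_0$, let $\pi=\pi_1(X,x_0)$, and let $P:\widetilde X\to X$ be the universal cover, on which $\pi$ acts by deck transformations. For $n\ge 2$ let $\prod_\pi\widetilde X$ be the quotient of $\widetilde X^n$ by the diagonal action of $\pi$, and let $q:\prod_\pi\widetilde X\to X^n$, $q([x_1,\dots,x_n])=(Px_1,\dots,Px_n)$. Let $$E=\{(\omega,x_1,\dots,x_n):\ \omega\in\widetilde X^{[0,1]},\ \omega(\tfrac{j-1}{n-1})=x_j \text{ for } 1\le j\le n\}/\pi,$$ that is, the space $\widetilde X^{[0,1]}$ of paths in $\widetilde X$ (with the compact-open topology) modulo $\pi$, which $[\omega]\mapsto P\circ\omega$ identifies with the free path space $X^{[0,1]}$. Let $p:E\to\prod_\pi\widetilde X$, $p([\omega])=[\omega(0),\omega(\tfrac1{n-1}),\dots,\omega(1)]$. Define $\widetilde{\operatorname{TC}}_n(X)$ to be the least integer $k\ge 1$ such that $X^n$ has an open cover $X^n=U_1\cup\dots\cup U_k$ for which $p$ admits a continuous section over each $q^{-1}(U_i)$ (and $\widetilde{\operatorname{TC}}_n(X)=\infty$ if there is no such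 $k$). Then the following are equivalent: (i) $\widetilde{\operatorname{TC}}_n(X)=1$ for some $n\ge 2$; (ii) $X$ is aspherical, i.e. $\pi_r(X)=0$ for all $r\ge 2$; (iii) $\widetilde{\operatorname{TC}}_n(X)=1$ for all $n\ge 2$. -/

import Mathlib

open scoped unitInterval Topology

noncomputable section

universe u v w

/-- A point of the universal cover of `X` based at `x₀`: the homotopy class, relative to the
endpoints, of a path in `X` that starts at `x₀`. -/
@[ext]
structure UniversalCover (X : Type u) [TopologicalSpace X] (x₀ : X) where
  /-- The endpoint of the path. -/
  pt : X
  /-- The homotopy class of the path. -/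
  cls : Path.Homotopic.Quotient x₀ pt

namespace UniversalCover

variable {X : Type u} [TopologicalSpace X] {x₀ : X}

/-- The covering projection `P`, which sends the class of a path to its endpoint. -/
def proj (a : UniversalCover X x₀) : X := a.pt

/-- The basic set `[γ]U`: all classes `[γ · η]` with `η` a path in `U` that starts at the
endpoint of `γ`. -/
def basicNhd (a : UniversalCover X x₀) (U : Set X) : Set (UniversalCover X x₀) :=
  {b | ∃ η : Path a.pt b.pt, (∀ t, η t ∈ U) ∧
    b.cls = a.cls.trans (Path.Homotopic.Quotient.mk η)}

/-- The usual topology of the universal cover, generated by the sets `[γ]U` with `U` an open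
neighbourhood of the endpoint of `γ`. -/
instance : TopologicalSpace (UniversalCover X x₀) :=
  TopologicalSpace.generateFrom
    {S | ∃ (a : UniversalCover X x₀) (U : Set X), IsOpen U ∧ a.pt ∈ U ∧ S = basicNhd a U}

/-- The action of the fundamental group by deck transformations, by composition with a loop at
the front. Mathlib's product in `FundamentalGroup X x₀` is composition of loops in the reverse
order, so a left action has to use the inverse loop. -/
instance : MulAction (FundamentalGroup X x₀) (UniversalCover X x₀) where
  smul g a := ⟨a.pt, Path.Homotopic.Quotient.trans (FundamentalGroup.toPath g⁻¹) a.cls⟩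
  one_smul a := by
    change UniversalCover.mk a.pt (Path.Homotopic.Quotient.trans
      (FundamentalGroup.toPath (1 : FundamentalGroup X x₀)⁻¹) a.cls) = a
    rw [inv_one, FundamentalGroup.one_def]
    exact congrArg (UniversalCover.mk a.pt) (Path.Homotopic.Quotient.refl_trans a.cls)
  mul_smul g h a := by
    change UniversalCover.mk a.pt (Path.Homotopic.Quotient.trans
        (FundamentalGroup.toPath (g * h)⁻¹) a.cls) =
      UniversalCover.mk a.pt (Path.Homotopic.Quotient.trans (FundamentalGroup.toPath g⁻¹)
        (Path.Homotopic.Quotient.trans (FundamentalGroup.toPath h⁻¹) a.cls))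
    rw [mul_inv_rev, FundamentalGroup.mul_def]
    exact congrArg (UniversalCover.mk a.pt) (Path.Homotopic.Quotient.trans_assoc _ _ _)

@[simp]
theorem smul_pt (g : FundamentalGroup X x₀) (a : UniversalCover X x₀) : (g • a).pt = a.pt := rfl

theorem smul_cls (g : FundamentalGroup X x₀) (a : UniversalCover X x₀) :
    (g • a).cls = Path.Homotopic.Quotient.trans (FundamentalGroup.toPath g⁻¹) a.cls := rfl

theorem smul_mem_basicNhd (g : FundamentalGroup X x₀) {a b : UniversalCover X x₀} {U : Set X}
    (h : b ∈ basicNhd a U) : g • b ∈ basicNhd (g • a) U := by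
  obtain ⟨η, hη, hb⟩ := h
  refine ⟨η, hη, ?_⟩
  rw [smul_cls, hb]
  exact (Path.Homotopic.Quotient.trans_assoc _ _ _).symm

instance : ContinuousConstSMul (FundamentalGroup X x₀) (UniversalCover X x₀) where
  continuous_const_smul g := by
    refine continuous_generateFrom_iff.2 ?_
    rintro S ⟨a, U, hU, ha, rfl⟩
    have h : (fun x => g • x) ⁻¹' basicNhd a U = basicNhd (g⁻¹ • a) U := by
      ext b
      constructor
      · intro hb
        simpa using smul_mem_basicNhd g⁻¹ hb
      · intro hb
        simpa using smul_mem_basicNhd g hb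
    rw [h]
    exact TopologicalSpace.isOpen_generateFrom_of_mem ⟨g⁻¹ • a, U, hU, ha, rfl⟩

end UniversalCover

/-- For maps `p : E → Y` and `q : Y → B`, the least `k ≥ 1` such that `B` has a cover by `k` open
sets `U i` for which `p` has a continuous section over each `q ⁻¹' U i`; it is `⊤` if there is no
such `k`. -/
def secatTilde {E : Type u} {Y : Type v} {B : Type w}
    [TopologicalSpace E] [TopologicalSpace Y] [TopologicalSpace B]
    (p : E → Y) (q : Y → B) : ℕ∞ :=
  sInf {m : ℕ∞ | ∃ k : ℕ, m = (k : ℕ∞) ∧ 1 ≤ k ∧ ∃ U : Fin k → Set B,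
    (∀ i, IsOpen (U i)) ∧ (⋃ i, U i) = Set.univ ∧
      ∀ i, ∃ s : C(q ⁻¹' U i, E), ∀ y : q ⁻¹' U i, p (s y) = y}

/-- The point `j / (n - 1)` of the unit interval, for `j = 0, …, n - 1`. -/
def gridPoint (n : ℕ) (j : Fin n) : I :=
  ⟨(j : ℝ) / ((n : ℝ) - 1), by
    have h : (j : ℝ) + 1 ≤ (n : ℝ) := by exact_mod_cast j.isLt
    have h0 : (0 : ℝ) ≤ (j : ℝ) := Nat.cast_nonneg _
    exact ⟨div_nonneg h0 (by linarith), div_le_one_of_le₀ (by linarith) (by linarith)⟩⟩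

section HigherTC

variable (n : ℕ) (X : Type u) [TopologicalSpace X] (x₀ : X)

/-- The quotient of the `n`-fold product of the universal cover by the diagonal action of the
fundamental group. -/
abbrev DiagonalQuotient : Type u :=
  MulAction.orbitRel.Quotient (FundamentalGroup X x₀) (Fin n → UniversalCover X x₀)

/-- The space of paths `ω` in the universal cover modulo the fundamental group, with the quotient
of the compact-open topology. It is the space of orbits `[ω, x₁, …, xₙ]` with
`ω (j / (n - 1)) = xⱼ₊₁`, as the points `xⱼ` are determined by `ω`, and `[ω] ↦ P ∘ ω` identifies
it with the free path space of `X`. -/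
abbrev PathQuotient : Type u :=
  MulAction.orbitRel.Quotient (FundamentalGroup X x₀) C(I, UniversalCover X x₀)

/-- The map `p`, which sends `[ω]` to `[ω 0, ω (1 / (n - 1)), …, ω 1]`. -/
def pathEvaluation : PathQuotient X x₀ → DiagonalQuotient n X x₀ :=
  Quotient.map' (fun ω j => ω (gridPoint n j)) (by
    rintro ω ω' ⟨g, rfl⟩
    exact ⟨g, rfl⟩)

/-- The map `q`, which sends `[x₁, …, xₙ]` to `(P x₁, …, P xₙ)`. -/
def diagonalProjection : DiagonalQuotient n X x₀ → (Fin n → X) :=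
  Quotient.lift (fun x j => (x j).proj) (by
    rintro x x' ⟨g, rfl⟩
    rfl)

/-- The invariant `TC̃ₙ(X)`. -/
def tcTilde : ℕ∞ :=
  secatTilde (pathEvaluation n X x₀) (diagonalProjection n X x₀)

end HigherTC

/-- A path-connected space is aspherical if its homotopy groups in degrees at least two vanish. -/
def IsAspherical (X : Type u) [TopologicalSpace X] : Prop :=
  PathConnectedSpace X ∧ ∀ r : ℕ, 2 ≤ r → ∀ x : X, Subsingleton (π_ r X x)

end

/-!
A section of `p` over all of `∏_π X̃` is the same as a continuous `π`-equivariant choice of paths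
through `n` given points of `X̃`. Fixing all points but one, such a choice contracts `X̃`, so the
higher homotopy groups of `X` vanish.

Conversely, if they vanish then all homotopy groups of `X̃` are trivial, so an equivariant choice
of a path from `x` to `y` can be made cell by cell over `X̃ × X̃`. The product topology may be
coarser than the weak topology of the product cells, so this choice need only be continuous on
products of compact sets. To repair this, deform `X` to a map `k` which is constant along the outer
half of every radius of every cell. Near each point `k` factors through a single closed cell, so
its lift to `X̃` sends some neighbourhood of each point into a compact set. The path from `x` to
`y` then follows the lifted deformation of `x`, the path chosen between the end points of the
deformations, and the deformation of `y` backwards.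
-/

/-- Semilocal simple connectivity, in the form the construction of the universal cover uses it:
every point has an open neighbourhood in which paths with common endpoints are homotopic in the
ambient space. -/
def IsSemilocallySimplyConnected (X : Type*) [TopologicalSpace X] : Prop :=
  ∀ x : X, ∃ V : Set X, IsOpen V ∧ x ∈ V ∧
    ∀ (y z : X) (p q : Path y z), (∀ t, p t ∈ V) → (∀ t, q t ∈ V) → p.Homotopic q

namespace UniversalCover

variable {X : Type*} [TopologicalSpace X] {x₀ : X}

theorem mem_basicNhd_self (a : UniversalCover X x₀) {U : Set X} (h : a.pt ∈ U) :
    a ∈ basicNhd a U :=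
  ⟨Path.refl _, fun _ => h, by
    rw [Path.Homotopic.Quotient.mk_refl, Path.Homotopic.Quotient.trans_refl]⟩

theorem pt_mem_of_mem_basicNhd {a b : UniversalCover X x₀} {U : Set X} (h : b ∈ basicNhd a U) :
    b.pt ∈ U := by
  obtain ⟨η, hη, -⟩ := h
  simpa using hη 1

theorem basicNhd_mono {a : UniversalCover X x₀} {U V : Set X} (h : U ⊆ V) :
    basicNhd a U ⊆ basicNhd a V := by
  rintro b ⟨η, hη, hb⟩
  exact ⟨η, fun t => h (hη t), hb⟩

theorem basicNhd_trans {a b c : UniversalCover X x₀} {U : Set X} (hb : b ∈ basicNhd a U)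
    (hc : c ∈ basicNhd b U) : c ∈ basicNhd a U := by
  obtain ⟨η, hη, hb⟩ := hb
  obtain ⟨θ, hθ, hc⟩ := hc
  refine ⟨η.trans θ, fun t => ?_, ?_⟩
  · rw [Path.trans_apply]
    split_ifs
    exacts [hη _, hθ _]
  · rw [hc, hb, Path.Homotopic.Quotient.mk_trans, Path.Homotopic.Quotient.trans_assoc]

theorem isOpen_basicNhd (a : UniversalCover X x₀) {U : Set X} (hU : IsOpen U) :
    IsOpen (basicNhd a U) := by
  by_cases h : a.pt ∈ U
  · exact TopologicalSpace.isOpen_generateFrom_of_mem ⟨a, U, hU, h, rfl⟩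
  · have : basicNhd a U = ∅ := by
      refine Set.eq_empty_of_forall_notMem fun b ⟨η, hη, _⟩ => h ?_
      simpa using hη 0
    rw [this]
    exact isOpen_empty

theorem exists_basicNhd_subset {S : Set (UniversalCover X x₀)} (hS : IsOpen S)
    {c : UniversalCover X x₀} (hc : c ∈ S) :
    ∃ U : Set X, IsOpen U ∧ c.pt ∈ U ∧ basicNhd c U ⊆ S := by
  induction hS with
  | basic s hs =>
    obtain ⟨a, U, hU, -, rfl⟩ := hs
    exact ⟨U, hU, pt_mem_of_mem_basicNhd hc, fun b hb => basicNhd_trans hc hb⟩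
  | univ => exact ⟨Set.univ, isOpen_univ, trivial, Set.subset_univ _⟩
  | inter s t _ _ hs ht =>
    obtain ⟨U, hU, hcU, hUs⟩ := hs hc.1
    obtain ⟨V, hV, hcV, hVt⟩ := ht hc.2
    exact ⟨U ∩ V, hU.inter hV, ⟨hcU, hcV⟩, fun b hb =>
      ⟨hUs (basicNhd_mono Set.inter_subset_left hb),
        hVt (basicNhd_mono Set.inter_subset_right hb)⟩⟩
  | sUnion S _ ih =>
    obtain ⟨s, hs, hcs⟩ := hc
    obtain ⟨U, hU, hcU, hUs⟩ := ih s hs hcs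
    exact ⟨U, hU, hcU, hUs.trans (Set.subset_sUnion_of_mem hs)⟩

theorem continuous_proj : Continuous (proj : UniversalCover X x₀ → X) := by
  refine ⟨fun U hU => ?_⟩
  have : proj ⁻¹' U = ⋃ a : {a : UniversalCover X x₀ // a.pt ∈ U}, basicNhd a.1 U := by
    ext b
    simp only [Set.mem_preimage, Set.mem_iUnion, Subtype.exists]
    exact ⟨fun h => ⟨b, h, mem_basicNhd_self b h⟩, fun ⟨a, _, h⟩ => pt_mem_of_mem_basicNhd h⟩
  rw [this]
  exact isOpen_iUnion fun a => isOpen_basicNhd _ hU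

theorem isOpenMap_proj [LocallyPathConnectedSpace X] :
    IsOpenMap (proj : UniversalCover X x₀ → X) := by
  intro S hS
  rw [isOpen_iff_mem_nhds]
  rintro _ ⟨c, hc, rfl⟩
  obtain ⟨U, hU, hcU, hUS⟩ := exists_basicNhd_subset hS hc
  refine Filter.mem_of_superset ((hU.pathComponentIn c.pt).mem_nhds
    (mem_pathComponentIn_self hcU)) ?_
  rintro y ⟨η, hη⟩
  exact ⟨⟨y, c.cls.trans (Path.Homotopic.Quotient.mk η)⟩, hUS ⟨η, hη, rfl⟩, rfl⟩

theorem surjective_proj [PathConnectedSpace X] :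
    Function.Surjective (proj : UniversalCover X x₀ → X) := fun x =>
  ⟨⟨x, Path.Homotopic.Quotient.mk (PathConnectedSpace.somePath x₀ x)⟩, rfl⟩

theorem proj_eq_iff_mem_orbit {a b : UniversalCover X x₀} :
    a.proj = b.proj ↔ a ∈ MulAction.orbit (FundamentalGroup X x₀) b := by
  constructor
  · obtain ⟨x, α⟩ := a
    obtain ⟨y, β⟩ := b
    rintro (rfl : x = y)
    refine ⟨(FundamentalGroup.fromPath (α.trans β.symm))⁻¹, ?_⟩
    refine UniversalCover.ext rfl (heq_of_eq ?_)
    change Path.Homotopic.Quotient.trans (FundamentalGroup.toPath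
      (FundamentalGroup.fromPath (α.trans β.symm))⁻¹⁻¹) β = α
    rw [inv_inv]
    change Path.Homotopic.Quotient.trans (α.trans β.symm) β = α
    rw [Path.Homotopic.Quotient.trans_assoc, Path.Homotopic.Quotient.symm_trans,
      Path.Homotopic.Quotient.trans_refl]
  · rintro ⟨g, rfl⟩
    rfl

theorem eq_one_of_smul_cls_eq {g : FundamentalGroup X x₀} {a : UniversalCover X x₀}
    (h : (g • a).cls = a.cls) : g = 1 := by
  rw [smul_cls] at h
  have h1 : FundamentalGroup.toPath g⁻¹ = Path.Homotopic.Quotient.refl x₀ := by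
    calc FundamentalGroup.toPath g⁻¹
        = ((FundamentalGroup.toPath g⁻¹).trans a.cls).trans a.cls.symm := by
          rw [Path.Homotopic.Quotient.trans_assoc, Path.Homotopic.Quotient.trans_symm,
            Path.Homotopic.Quotient.trans_refl]
      _ = Path.Homotopic.Quotient.refl x₀ := by rw [h, Path.Homotopic.Quotient.trans_symm]
  have h2 : g⁻¹ = 1 := h1
  exact inv_eq_one.1 h2

theorem isQuotientCoveringMap_proj [PathConnectedSpace X] [LocallyPathConnectedSpace X]
    (hX : IsSemilocallySimplyConnected X) :
    IsQuotientCoveringMap (proj : UniversalCover X x₀ → X) (FundamentalGroup X x₀) where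
  toIsQuotientMap := isOpenMap_proj.isQuotientMap continuous_proj surjective_proj
  continuous_const_smul := continuous_const_smul
  apply_eq_iff_mem_orbit := proj_eq_iff_mem_orbit
  disjoint e := by
    obtain ⟨V, hV, heV, hhV⟩ := hX e.pt
    refine ⟨basicNhd e V, (isOpen_basicNhd e hV).mem_nhds (mem_basicNhd_self e heV), ?_⟩
    rintro g ⟨_, ⟨c, ⟨η, hη, hc⟩, rfl⟩, ⟨θ, hθ, hgc⟩⟩
    refine eq_one_of_smul_cls_eq (a := c) ?_
    rw [hc, hgc]
    exact congrArg _ (Path.Homotopic.Quotient.eq.2 (hhV _ _ _ _ hθ hη))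

theorem t2Space [T2Space X] [PathConnectedSpace X] [LocallyPathConnectedSpace X]
    (hX : IsSemilocallySimplyConnected X) : T2Space (UniversalCover X x₀) :=
  ⟨fun a b hab => by
    by_cases h : a.proj = b.proj
    · exact (isQuotientCoveringMap_proj hX).isCoveringMap.isSeparatedMap a b h hab
    · exact separated_by_continuous continuous_proj h⟩

/-- The lift of a path to the universal cover, whose value at `t` is the class of the initial
segment of the path up to the time `t`. -/
noncomputable def pathLift (a : UniversalCover X x₀) {y : X} (η : Path a.pt y) (t : I) :
    UniversalCover X x₀ :=
  ⟨η t, a.cls.trans ((Path.Homotopic.Quotient.mk (η.subpath 0 t)).cast η.source.symm rfl)⟩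

theorem pathLift_cls_trans_subpath (a : UniversalCover X x₀) {y : X} (η : Path a.pt y) (t s : I) :
    (pathLift a η s).cls =
      (pathLift a η t).cls.trans (Path.Homotopic.Quotient.mk (η.subpath t s)) := by
  have trans_cast : ∀ {x : X} (hx : x = η 0) (α : Path.Homotopic.Quotient (η 0) (η t))
      (β : Path.Homotopic.Quotient (η t) (η s)),
      (α.trans β).cast hx rfl = (α.cast hx rfl).trans β := by
    rintro x rfl α β
    rw [Path.Homotopic.Quotient.cast_rfl_rfl, Path.Homotopic.Quotient.cast_rfl_rfl]
  have mk_subpath : Path.Homotopic.Quotient.mk (η.subpath 0 s) =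
      (Path.Homotopic.Quotient.mk (η.subpath 0 t)).trans
        (Path.Homotopic.Quotient.mk (η.subpath t s)) :=
    (Path.Homotopic.Quotient.eq.2 ⟨Path.Homotopy.subpathTransSubpath η 0 t s⟩).symm
  refine (congrArg (Path.Homotopic.Quotient.trans a.cls) ?_).trans
    (Path.Homotopic.Quotient.trans_assoc _ _ _).symm
  rw [mk_subpath]
  exact trans_cast _ _ _

theorem pathLift_mem_basicNhd (a : UniversalCover X x₀) {y : X} (η : Path a.pt y) {t s : I}
    {U : Set X} (hU : ∀ r ∈ Set.uIcc t s, η r ∈ U) :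
    pathLift a η s ∈ basicNhd (pathLift a η t) U := by
  refine ⟨η.subpath t s, fun r => ?_, pathLift_cls_trans_subpath a η t s⟩
  obtain ⟨r', hr', hr⟩ : η.subpath t s r ∈ η '' Set.uIcc t s :=
    Path.range_subpath η t s ▸ Set.mem_range_self r
  exact (congrArg (· ∈ U) hr).mp (hU r' hr')

theorem continuous_pathLift (a : UniversalCover X x₀) {y : X} (η : Path a.pt y) :
    Continuous (pathLift a η) := by
  refine continuous_iff_continuousAt.2 fun t => Filter.tendsto_def.2 fun S hS => ?_
  obtain ⟨S', hS'S, hS', htS'⟩ := mem_nhds_iff.1 hS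
  obtain ⟨U, hU, htU, hUS⟩ := exists_basicNhd_subset hS' htS'
  obtain ⟨ε, hε, hεU⟩ := Metric.mem_nhds_iff.1 ((hU.preimage η.continuous).mem_nhds htU)
  refine Filter.mem_of_superset (Metric.ball_mem_nhds t hε) fun s hs => hS'S (hUS ?_)
  refine pathLift_mem_basicNhd a η fun r hr => hεU (Metric.mem_ball.2 ?_)
  have hr' : (r : ℝ) ∈ Set.uIcc (t : ℝ) s := by
    rw [Set.mem_uIcc] at hr ⊢
    exact hr
  exact (Set.abs_sub_left_of_mem_uIcc hr').trans_lt (Metric.mem_ball.1 hs)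

theorem pathLift_zero (a : UniversalCover X x₀) {y : X} (η : Path a.pt y) :
    pathLift a η 0 = a := by
  have h : ∀ (z : X) (hz : a.pt = z) (β : Path.Homotopic.Quotient z z),
      β = Path.Homotopic.Quotient.refl z →
      (⟨z, a.cls.trans (β.cast hz rfl)⟩ : UniversalCover X x₀) = a := by
    rintro z rfl β rfl
    rw [Path.Homotopic.Quotient.cast_rfl_rfl, Path.Homotopic.Quotient.trans_refl]
  refine h _ η.source.symm _ ?_
  rw [Path.subpath_self, Path.Homotopic.Quotient.mk_refl]

theorem pathLift_one (a : UniversalCover X x₀) {y : X} (η : Path a.pt y) :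
    pathLift a η 1 = ⟨y, a.cls.trans (Path.Homotopic.Quotient.mk η)⟩ := by
  have h : ∀ (z : X) (hz : z = y) (β : Path.Homotopic.Quotient a.pt z),
      β = (Path.Homotopic.Quotient.mk η).cast rfl hz →
      (⟨z, a.cls.trans β⟩ : UniversalCover X x₀) =
        ⟨y, a.cls.trans (Path.Homotopic.Quotient.mk η)⟩ := by
    rintro z rfl β rfl
    rw [Path.Homotopic.Quotient.cast_rfl_rfl]
  refine h _ η.target _ ?_
  rw [Path.subpath_zero_one, Path.Homotopic.Quotient.mk_cast,
    Path.Homotopic.Quotient.cast_cast]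

theorem pathConnectedSpace : PathConnectedSpace (UniversalCover X x₀) := by
  have h : ∀ a : UniversalCover X x₀,
      Joined (⟨x₀, Path.Homotopic.Quotient.refl x₀⟩ : UniversalCover X x₀) a := by
    rintro ⟨y, α⟩
    induction α using Path.Homotopic.Quotient.ind with | mk η =>
    refine ⟨⟨⟨_, continuous_pathLift ⟨x₀, Path.Homotopic.Quotient.refl x₀⟩ η⟩, ?_, ?_⟩⟩
    · exact pathLift_zero ⟨x₀, Path.Homotopic.Quotient.refl x₀⟩ η
    · refine (pathLift_one ⟨x₀, Path.Homotopic.Quotient.refl x₀⟩ η).trans ?_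
      rw [Path.Homotopic.Quotient.refl_trans]
  exact ⟨⟨⟨x₀, Path.Homotopic.Quotient.refl x₀⟩⟩, fun a b => (h a).symm.trans (h b)⟩

theorem cls_eq_trans_map [PathConnectedSpace X] [LocallyPathConnectedSpace X]
    (hX : IsSemilocallySimplyConnected X) {a b : UniversalCover X x₀} (ω : Path a b) :
    b = ⟨b.pt, a.cls.trans (Path.Homotopic.Quotient.mk (ω.map continuous_proj))⟩ := by
  have cov := (isQuotientCoveringMap_proj (x₀ := x₀) hX).isCoveringMap
  have h := cov.eq_of_comp_eq ω.continuous (continuous_pathLift a (ω.map continuous_proj)) rfl 0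
    (by rw [ω.source]; exact (pathLift_zero a _).symm)
  have h1 := congrFun h 1
  rw [ω.target] at h1
  exact h1.trans (pathLift_one a (ω.map continuous_proj))

theorem simplyConnectedSpace [PathConnectedSpace X] [LocallyPathConnectedSpace X]
    (hX : IsSemilocallySimplyConnected X) : SimplyConnectedSpace (UniversalCover X x₀) := by
  have cov := (isQuotientCoveringMap_proj (x₀ := x₀) hX).isCoveringMap
  refine simply_connected_iff_loops_nullhomotopic.2 ⟨pathConnectedSpace, fun a ω => ?_⟩
  refine Path.Homotopic.Quotient.eq.1 (cov.injective_path_homotopic_map a a ?_)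
  have h : a.cls = a.cls.trans (Path.Homotopic.Quotient.mk (ω.map continuous_proj)) :=
    eq_of_heq (UniversalCover.ext_iff.1 (cls_eq_trans_map hX ω)).2
  have key : ∀ β : Path.Homotopic.Quotient a.pt a.pt, a.cls = a.cls.trans β →
      β = Path.Homotopic.Quotient.refl a.pt := by
    intro β hβ
    have h1 : a.cls.symm.trans (a.cls.trans β) = β := by
      rw [← Path.Homotopic.Quotient.trans_assoc, Path.Homotopic.Quotient.symm_trans,
        Path.Homotopic.Quotient.refl_trans]
    rw [← h1, ← hβ, Path.Homotopic.Quotient.symm_trans]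
  exact key _ h

end UniversalCover

section SphereFilling

open Metric Set

theorem norm_inv_smul_mem_sphere {W : Type*} [NormedAddCommGroup W] [NormedSpace ℝ W] {z : W}
    (hz : z ≠ 0) : ‖z‖⁻¹ • z ∈ sphere (0 : W) 1 := by
  rw [mem_sphere_zero_iff_norm, norm_smul, norm_inv, norm_norm]
  exact inv_mul_cancel₀ (norm_ne_zero_iff.2 hz)

theorem continuousOn_norm_inv_smul {W : Type*} [NormedAddCommGroup W] [NormedSpace ℝ W] :
    ContinuousOn (fun z : W => ‖z‖⁻¹ • z) {0}ᶜ :=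
  ContinuousOn.smul (f := fun z : W => ‖z‖⁻¹)
    (ContinuousOn.inv₀ (by fun_prop) fun _ h => norm_ne_zero_iff.2 h) continuousOn_id

section RadialExtension

variable {Y : Type*} [TopologicalSpace Y] {W : Type*} [NormedAddCommGroup W] [NormedSpace ℝ W]
  {m : W → Y} {φ : W → I → Y}

theorem exists_radial_extension (hm : ContinuousOn m (closedBall 0 1))
    (hφ : ContinuousOn (fun q : W × I => φ q.1 q.2) (sphere 0 1 ×ˢ univ))
    (hφm : ∀ z ∈ sphere (0 : W) 1, φ z 0 = m z) :
    ∃ G : W → Y, Continuous G ∧ EqOn G m (closedBall 0 1) ∧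
      ∀ z ∈ sphere (0 : W) 1, ∀ t : I, G ((1 + (t : ℝ)) • z) = φ z t := by
  classical
  let G : W → Y := fun v =>
    if ‖v‖ ≤ 1 then m v else φ (‖v‖⁻¹ • v) (projIcc 0 1 zero_le_one (‖v‖ - 1))
  have hclosure : closure {v : W | ¬‖v‖ ≤ 1} ⊆ {0}ᶜ := by
    rintro v hv rfl
    have : 1 ≤ ‖(0 : W)‖ := closure_minimal (fun w (hw : ¬‖w‖ ≤ 1) => (not_le.1 hw).le)
      (isClosed_le continuous_const continuous_norm) hv
    norm_num at this
  refine ⟨G, continuous_if ?_ ?_ ?_, fun v hv => if_pos (mem_closedBall_zero_iff.1 hv), ?_⟩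
  · intro v hv
    have hv1 : ‖v‖ = 1 := frontier_le_subset_eq continuous_norm continuous_const hv
    rw [hv1, sub_self, projIcc_left, inv_one, one_smul]
    exact (hφm v (mem_sphere_zero_iff_norm.2 hv1)).symm
  · refine hm.mono (closure_minimal (fun v hv => mem_closedBall_zero_iff.2 hv) isClosed_closedBall)
  · have hproj : Continuous fun v : W => projIcc (0 : ℝ) 1 zero_le_one (‖v‖ - 1) :=
      continuous_projIcc.comp (by fun_prop)
    exact hφ.comp ((continuousOn_norm_inv_smul.mono hclosure).prodMk hproj.continuousOn)
      fun v hv => ⟨norm_inv_smul_mem_sphere (hclosure hv), trivial⟩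
  · intro z hz t
    have hz1 := mem_sphere_zero_iff_norm.1 hz
    have hnorm : ‖(1 + (t : ℝ)) • z‖ = 1 + t := by
      rw [norm_smul, hz1, mul_one, Real.norm_of_nonneg (by linarith [t.2.1])]
    rcases t.2.1.eq_or_lt with ht | ht
    · obtain rfl : t = 0 := Subtype.ext ht.symm
      simp only [Icc.coe_zero, add_zero, one_smul, hφm z hz]
      exact if_pos hz1.le
    · simp only [G, hnorm]
      rw [if_neg (by linarith), smul_smul, inv_mul_cancel₀ (by linarith), one_smul,
        add_sub_cancel_left, projIcc_val]

theorem exists_extend_closedBall_of_homotopy (hm : ContinuousOn m (closedBall 0 1))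
    (hφ : ContinuousOn (fun q : W × I => φ q.1 q.2) (sphere 0 1 ×ˢ univ))
    (hφm : ∀ z ∈ sphere (0 : W) 1, φ z 0 = m z) :
    ∃ G : W → Y, Continuous G ∧ ∀ z ∈ sphere (0 : W) 1, G z = φ z 1 := by
  obtain ⟨G, hG, -, hGφ⟩ := exists_radial_extension hm hφ hφm
  refine ⟨fun w => G ((2 : ℝ) • w), hG.comp (continuous_const_smul _), fun z hz => ?_⟩
  rw [← hGφ z hz 1, Icc.coe_one, one_add_one_eq_two]

theorem exists_extend_paths_of_sphere (hm : ContinuousOn m (closedBall 0 1))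
    (hφ : ContinuousOn (fun q : W × I => φ q.1 q.2) (sphere 0 1 ×ˢ univ))
    (hφm : ∀ z ∈ sphere (0 : W) 1, φ z 0 = m z) :
    ∃ ψ : W → C(I, Y), Continuous ψ ∧ (∀ z ∈ closedBall (0 : W) 1, ψ z 0 = m z) ∧
      (∀ z ∈ sphere (0 : W) 1, ∀ t, ψ z t = φ z t) ∧
      ∀ z ∈ closedBall (0 : W) 1, 1 / 2 ≤ ‖z‖ → ψ z 1 = ψ (‖z‖⁻¹ • z) 1 := by
  obtain ⟨G, hG, hGm, hGφ⟩ := exists_radial_extension hm hφ hφm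
  -- The path from `z` in the outer half of the ball runs radially to the sphere of radius `2`.
  let k : W → ℝ := fun z => (2 - max ‖z‖ (1 / 2)) / max ‖z‖ (1 / 2)
  have hk : Continuous k := Continuous.div (by fun_prop) (by fun_prop) fun z =>
    ne_of_gt (lt_of_lt_of_le (by norm_num) (le_max_right _ _))
  have hk1 : ∀ z ∈ sphere (0 : W) 1, k z = 1 := by
    intro z hz
    simp only [k, mem_sphere_zero_iff_norm.1 hz]
    norm_num
  let ψ : C(W × I, Y) := ⟨fun q => G ((1 + (q.2 : ℝ) * k q.1) • q.1), hG.comp (by fun_prop)⟩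
  refine ⟨fun z => ψ.curry z, ψ.curry.continuous, fun z hz => ?_, fun z hz t => ?_,
    fun z _ hz2 => ?_⟩
  · change G ((1 + ((0 : I) : ℝ) * k z) • z) = m z
    rw [Icc.coe_zero, zero_mul, add_zero, one_smul, hGm hz]
  · change G ((1 + (t : ℝ) * k z) • z) = φ z t
    rw [hk1 z hz, mul_one, hGφ z hz]
  · have hz0 : ‖z‖ ≠ 0 := by linarith
    change G ((1 + ((1 : I) : ℝ) * k z) • z) =
      G ((1 + ((1 : I) : ℝ) * k (‖z‖⁻¹ • z)) • (‖z‖⁻¹ • z))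
    rw [hk1 _ (norm_inv_smul_mem_sphere (norm_ne_zero_iff.1 hz0)), smul_smul]
    congr 2
    simp only [k, max_eq_left hz2, Icc.coe_one]
    field_simp
    ring

end RadialExtension

section CubeChart

variable {N : ℕ} {V : Type*} [NormedAddCommGroup V] (e : V ≃ᵢ (Fin N → ℝ))

/-- The affine map from the unit cube onto the unit ball of a space isometric to `ℝᴺ` with the
sup norm. It transports maps on the ball to the cubes used in the definition of `π_ N`. -/
noncomputable def cubeToBall : C(Fin N → I, V) where
  toFun c := e.symm fun i => 2 * (c i : ℝ) - 1
  continuous_toFun := e.symm.continuous.comp (continuous_pi fun i => by fun_prop)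

/-- The retraction of a space isometric to `ℝᴺ` onto the unit cube that inverts `cubeToBall` on
the unit ball. -/
noncomputable def ballToCube : C(V, Fin N → I) where
  toFun z i := projIcc 0 1 zero_le_one ((e z i + 1) / 2)
  continuous_toFun := continuous_pi fun i => continuous_projIcc.comp
    ((((continuous_apply i).comp e.continuous).add continuous_const).div_const 2)

variable {e}

theorem norm_isometryEquiv_apply (he : e 0 = 0) (z : V) : ‖e z‖ = ‖z‖ := by
  rw [← dist_zero_right, ← dist_zero_right z, ← he, e.dist_eq]

theorem cubeToBall_mem_closedBall (he : e 0 = 0) (c : Fin N → I) :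
    cubeToBall e c ∈ closedBall (0 : V) 1 := by
  rw [mem_closedBall_zero_iff, ← norm_isometryEquiv_apply he, cubeToBall, ContinuousMap.coe_mk,
    e.apply_symm_apply]
  refine (pi_norm_le_iff_of_nonneg zero_le_one).2 fun i => ?_
  rw [Real.norm_eq_abs, abs_le]
  exact ⟨by linarith [(c i).2.1], by linarith [(c i).2.2]⟩

theorem cubeToBall_mem_sphere (he : e 0 = 0) {c : Fin N → I} (hc : c ∈ Cube.boundary (Fin N)) :
    cubeToBall e c ∈ sphere (0 : V) 1 := by
  obtain ⟨i, hi⟩ := hc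
  rw [mem_sphere_zero_iff_norm]
  refine le_antisymm (mem_closedBall_zero_iff.1 (cubeToBall_mem_closedBall he c)) ?_
  rw [← norm_isometryEquiv_apply he, cubeToBall, ContinuousMap.coe_mk, e.apply_symm_apply]
  refine le_trans ?_ (norm_le_pi_norm (fun i => 2 * (c i : ℝ) - 1) i)
  rcases hi with hi | hi <;> norm_num [hi]

theorem cubeToBall_ballToCube (he : e 0 = 0) {z : V} (hz : z ∈ closedBall (0 : V) 1) :
    cubeToBall e (ballToCube e z) = z := by
  rw [mem_closedBall_zero_iff, ← norm_isometryEquiv_apply he,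
    pi_norm_le_iff_of_nonneg zero_le_one] at hz
  refine e.symm_apply_eq.2 (funext fun i => ?_)
  have hi := abs_le.1 (hz i)
  have hval : ((ballToCube e z i : I) : ℝ) = (e z i + 1) / 2 :=
    congrArg Subtype.val (projIcc_of_mem zero_le_one
      (show (e z i + 1) / 2 ∈ Icc (0 : ℝ) 1 from ⟨by linarith, by linarith⟩))
  rw [hval]
  ring

theorem ballToCube_mem_boundary (he : e 0 = 0) {z : V} (hz : z ∈ sphere (0 : V) 1) :
    ballToCube e z ∈ Cube.boundary (Fin N) := by
  rw [mem_sphere_zero_iff_norm, ← norm_isometryEquiv_apply he] at hz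
  obtain ⟨i, hi⟩ : ∃ i, 1 ≤ ‖e z i‖ := by
    by_contra! h
    exact absurd hz (ne_of_lt ((pi_norm_lt_iff zero_lt_one).2 h))
  refine ⟨i, ?_⟩
  rcases le_abs.1 hi with h | h
  · exact Or.inr (projIcc_of_right_le zero_le_one (by linarith))
  · exact Or.inl (projIcc_of_le_left zero_le_one (by linarith))

variable {Y : Type*} [TopologicalSpace Y]

theorem exists_nullhomotopy_of_subsingleton_homotopyGroup (he : e 0 = 0) {y : Y}
    (hY : Subsingleton (HomotopyGroup.Pi N Y y)) {g : V → Y}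
    (hg : ContinuousOn g (closedBall 0 1)) (hgy : ∀ z ∈ sphere (0 : V) 1, g z = y) :
    ∃ H : C(I × V, Y), (∀ z, H (0, z) = y) ∧ (∀ z ∈ closedBall (0 : V) 1, H (1, z) = g z) ∧
      ∀ t, ∀ z ∈ sphere (0 : V) 1, H (t, z) = y := by
  let γ : GenLoop (Fin N) Y y :=
    ⟨⟨fun c => g (cubeToBall e c),
      hg.comp_continuous (cubeToBall e).continuous (cubeToBall_mem_closedBall he)⟩,
      fun c hc => hgy _ (cubeToBall_mem_sphere he hc)⟩
  obtain ⟨F⟩ : GenLoop.Homotopic GenLoop.const γ :=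
    Quotient.exact (Subsingleton.elim (α := HomotopyGroup.Pi N Y y) ⟦GenLoop.const⟧ ⟦γ⟧)
  refine ⟨⟨fun q => F (q.1, ballToCube e q.2), by fun_prop⟩, fun z => F.apply_zero _,
    fun z hz => ?_, fun t z hz => F.eq_fst _ (ballToCube_mem_boundary he hz)⟩
  refine (F.apply_one _).trans ?_
  change g (cubeToBall e (ballToCube e z)) = g z
  rw [cubeToBall_ballToCube he hz]

theorem two_mul_sub_one_mem_closedBall (t : I) : 2 * (t : ℝ) - 1 ∈ closedBall (0 : ℝ) 1 :=
  mem_closedBall_zero_iff.2 (abs_le.2 ⟨by linarith [t.2.1], by linarith [t.2.2]⟩)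

theorem mem_sphere_zero_prod {W : Type*} [NormedAddCommGroup W] {z : V × W} {r : ℝ} :
    z ∈ sphere 0 r ↔ z.1 ∈ sphere 0 r ∧ z.2 ∈ closedBall 0 r ∨
      z.1 ∈ closedBall 0 r ∧ z.2 ∈ sphere 0 r := by
  rw [← Prod.mk_zero_zero, sphere_prod]
  rfl

theorem abs_fst_eq_one_or_norm_snd_eq_one {w : ℝ × V} (hw : w ∈ sphere (0 : ℝ × V) 1) :
    |w.1| = 1 ∨ ‖w.2‖ = 1 := by
  rcases mem_sphere_zero_prod.1 hw with ⟨h, -⟩ | ⟨-, h⟩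
  · exact Or.inl (mem_sphere_zero_iff_norm.1 h)
  · exact Or.inr (mem_sphere_zero_iff_norm.1 h)

theorem abs_fst_le_one {w : ℝ × V} (hw : w ∈ sphere (0 : ℝ × V) 1) : |w.1| ≤ 1 :=
  (norm_fst_le w).trans (mem_sphere_zero_iff_norm.1 hw).le

theorem norm_snd_le_one {w : ℝ × V} (hw : w ∈ sphere (0 : ℝ × V) 1) : ‖w.2‖ ≤ 1 :=
  (norm_snd_le w).trans (mem_sphere_zero_iff_norm.1 hw).le

theorem exists_extend_upper_hemisphere [NormedSpace ℝ V] (he : e 0 = 0) {y : Y}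
    (hY : Subsingleton (HomotopyGroup.Pi N Y y)) {g : V → Y}
    (hg : ContinuousOn g (closedBall 0 1)) (hgy : ∀ z ∈ sphere (0 : V) 1, g z = y) :
    ∃ F : ℝ × V → Y, Continuous F ∧ (∀ w ∈ sphere (0 : ℝ × V) 1, 0 ≤ w.1 → F w = g w.2) ∧
      ∀ w ∈ sphere (0 : ℝ × V) 1, w.1 < 0 → F w = y := by
  classical
  obtain ⟨H, hH0, hH1, hHs⟩ := exists_nullhomotopy_of_subsingleton_homotopyGroup he hY hg hgy
  let φ : ℝ × V → I → Y := fun w t => if 0 ≤ w.1 then H (t, w.2) else y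
  have hφ : ContinuousOn (fun q : (ℝ × V) × I => φ q.1 q.2) (sphere 0 1 ×ˢ univ) := by
    refine ContinuousOn.if ?_ (H.continuous.comp (by fun_prop)).continuousOn continuousOn_const
    rintro ⟨w, t⟩ ⟨⟨hw, -⟩, hw0⟩
    have h0 : 0 = w.1 := frontier_le_subset_eq (f := fun _ => 0)
      (g := fun q : (ℝ × V) × I => q.1.1) continuous_const (by fun_prop) hw0
    refine hHs _ _ (mem_sphere_zero_iff_norm.2 ?_)
    exact (abs_fst_eq_one_or_norm_snd_eq_one hw).resolve_left (by norm_num [← h0])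
  obtain ⟨F, hF, hFφ⟩ := exists_extend_closedBall_of_homotopy (m := fun _ => y)
    continuousOn_const hφ fun w _ => by simp only [φ, hH0, ite_self]
  refine ⟨F, hF, fun w hw h => ?_, fun w hw h => ?_⟩
  · rw [hFφ w hw]
    exact (if_pos h).trans (hH1 _ (mem_closedBall_zero_iff.2 (norm_snd_le_one hw)))
  · rw [hFφ w hw]
    exact if_neg h.not_ge

end CubeChart

section SphereCollapse

variable {V : Type*} [NormedAddCommGroup V]

/-- The gauge that is `1` on the lower half of the unit sphere of `ℝ × V` and on its equator, and
equals `‖w.2‖` on the upper half. -/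
noncomputable def collapseGauge (w : ℝ × V) : ℝ := max ‖w.2‖ (min 1 (1 - w.1))

variable [NormedSpace ℝ V]

/-- The map that wraps the unit ball of `V` once around the origin of `ℝ × V`, with the centre
going to `(1, 0)` and the whole boundary to `(-1, 0)`. -/
noncomputable def wrapBall (z : V) : ℝ × V := (1 - 2 * ‖z‖, (1 - ‖z‖) • z)

/-- A self-map of `ℝ × V` that is homotopic to the identity on the unit sphere in the complement
of the origin and sends the lower half of the sphere to the point `(-1, 0)`. -/
noncomputable def sphereCollapse (w : ℝ × V) : ℝ × V :=
  (1 - 2 * collapseGauge w, (1 - collapseGauge w) • w.2)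

theorem continuous_wrapBall : Continuous (wrapBall : V → ℝ × V) := by
  unfold wrapBall
  fun_prop

theorem continuous_sphereCollapse : Continuous (sphereCollapse : ℝ × V → ℝ × V) := by
  unfold sphereCollapse collapseGauge
  fun_prop

theorem wrapBall_ne_zero (z : V) : wrapBall z ≠ 0 := by
  intro hz
  have h1 : 1 - 2 * ‖z‖ = 0 := congrArg Prod.fst hz
  rcases smul_eq_zero.1 (congrArg Prod.snd hz : (1 - ‖z‖) • z = 0) with h | h
  · linarith
  · rw [h, norm_zero] at h1
    norm_num at h1

theorem wrapBall_of_mem_sphere {z : V} (hz : z ∈ sphere (0 : V) 1) : wrapBall z = (-1, 0) := by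
  rw [wrapBall, mem_sphere_zero_iff_norm.1 hz]
  norm_num

theorem sphereCollapse_of_nonneg {w : ℝ × V} (hw : w ∈ sphere (0 : ℝ × V) 1) (h : 0 ≤ w.1) :
    sphereCollapse w = wrapBall w.2 := by
  have hgauge : collapseGauge w = ‖w.2‖ := by
    refine max_eq_left ?_
    rcases abs_fst_eq_one_or_norm_snd_eq_one hw with h1 | h1
    · rw [← abs_of_nonneg h, h1]
      simp
    · rw [h1]
      exact min_le_left _ _
  rw [sphereCollapse, wrapBall, hgauge]

theorem sphereCollapse_of_neg {w : ℝ × V} (hw : w ∈ sphere (0 : ℝ × V) 1) (h : w.1 < 0) :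
    sphereCollapse w = (-1, 0) := by
  have hgauge : collapseGauge w = 1 := by
    rw [collapseGauge, min_eq_left (by linarith)]
    exact max_eq_right (norm_snd_le_one hw)
  rw [sphereCollapse, hgauge]
  norm_num

theorem segment_sphereCollapse_ne_zero {w : ℝ × V} (hw : w ∈ sphere (0 : ℝ × V) 1) (t : I) :
    (1 - (t : ℝ)) • w + (t : ℝ) • sphereCollapse w ≠ 0 := by
  intro hz
  have h1 : (1 - t) * w.1 + t * (1 - 2 * collapseGauge w) = 0 := congrArg Prod.fst hz
  have h2 : (1 - t * collapseGauge w) • w.2 = 0 := by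
    rw [← show (1 - (t : ℝ)) • w.2 + (t : ℝ) • ((1 - collapseGauge w) • w.2) = 0 from
      congrArg Prod.snd hz]
    module
  rcases smul_eq_zero.1 h2 with h | h
  · have hgauge : collapseGauge w ≤ 1 := max_le (norm_snd_le_one hw) (min_le_left _ _)
    have ht : (t : ℝ) = 1 := by nlinarith [t.2.1, t.2.2]
    rw [ht] at h h1
    linarith
  · have hgauge : collapseGauge w = min 1 (1 - w.1) := by
      rw [collapseGauge, h, norm_zero]
      exact max_eq_right (le_min zero_le_one (by linarith [(abs_le.1 (abs_fst_le_one hw)).2]))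
    have hw1 : |w.1| = 1 :=
      (abs_fst_eq_one_or_norm_snd_eq_one hw).resolve_right (by rw [h, norm_zero]; norm_num)
    rcases eq_or_eq_neg_of_abs_eq hw1 with h3 | h3
    · rw [hgauge, h3] at h1
      norm_num at h1
    · rw [hgauge, h3] at h1
      norm_num at h1
      linarith

end SphereCollapse

theorem exists_extend_closedBall_of_subsingleton_homotopyGroup {Y : Type*} [TopologicalSpace Y]
    {N : ℕ} {V : Type*} [NormedAddCommGroup V] [NormedSpace ℝ V] {e : V ≃ᵢ (Fin N → ℝ)}
    (he : e 0 = 0) (hY : ∀ y : Y, Subsingleton (HomotopyGroup.Pi N Y y)) {f : ℝ × V → Y}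
    (hf : ContinuousOn f (sphere 0 1)) :
    ∃ F : ℝ × V → Y, Continuous F ∧ ∀ w ∈ sphere (0 : ℝ × V) 1, F w = f w := by
  let f' : ℝ × V → Y := fun w => f (‖w‖⁻¹ • w)
  have hf' : ContinuousOn f' {0}ᶜ :=
    hf.comp continuousOn_norm_inv_smul fun w hw => norm_inv_smul_mem_sphere hw
  have hf'f : ∀ w ∈ sphere (0 : ℝ × V) 1, f' w = f w := fun w hw => by
    simp only [f', mem_sphere_zero_iff_norm.1 hw, inv_one, one_smul]
  obtain ⟨F, hF, hFnonneg, hFneg⟩ := exists_extend_upper_hemisphere he (hY (f' (-1, 0)))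
    (g := fun z => f' (wrapBall z))
    (hf'.comp continuous_wrapBall.continuousOn fun z _ => wrapBall_ne_zero z)
    fun z hz => congrArg f' (wrapBall_of_mem_sphere hz)
  have hFcollapse : ∀ w ∈ sphere (0 : ℝ × V) 1, F w = f' (sphereCollapse w) := by
    intro w hw
    rcases le_or_gt 0 w.1 with h | h
    · rw [hFnonneg w hw h, sphereCollapse_of_nonneg hw h]
    · rw [hFneg w hw h, sphereCollapse_of_neg hw h]
  let φ : ℝ × V → I → Y := fun w t =>
    f' ((1 - (σ t : ℝ)) • w + (σ t : ℝ) • sphereCollapse w)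
  have hφ : ContinuousOn (fun q : (ℝ × V) × I => φ q.1 q.2) (sphere 0 1 ×ˢ univ) :=
    hf'.comp (Continuous.continuousOn (by have := continuous_sphereCollapse (V := V); fun_prop))
      fun q hq => segment_sphereCollapse_ne_zero hq.1 (σ q.2)
  obtain ⟨G, hG, hGφ⟩ := exists_extend_closedBall_of_homotopy hF.continuousOn hφ fun w hw => by
    simp [φ, hFcollapse w hw]
  refine ⟨G, hG, fun w hw => (hGφ w hw).trans ?_⟩
  simpa [φ] using hf'f w hw

end SphereFilling

theorem continuousOn_image_of_isCompact {T Z W : Type*} [TopologicalSpace T]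
    [TopologicalSpace Z] [TopologicalSpace W] [T2Space Z] {m : T → Z} {s : Z → W} {K : Set T}
    (hK : IsCompact K) (hm : ContinuousOn m K) (hs : ContinuousOn (s ∘ m) K) :
    ContinuousOn s (m '' K) := by
  rw [continuousOn_iff_isClosed]
  intro C hC
  obtain ⟨D, hD, e⟩ := continuousOn_iff_isClosed.1 hs C hC
  refine ⟨m '' (D ∩ K), ((hK.inter_left hD).image_of_continuousOn
    (hm.mono Set.inter_subset_right)).isClosed, ?_⟩
  ext y
  constructor
  · rintro ⟨hy, z, hz, rfl⟩
    exact ⟨⟨z, e ▸ ⟨hy, hz⟩, rfl⟩, z, hz, rfl⟩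
  · rintro ⟨⟨z, hz, rfl⟩, hz'⟩
    exact ⟨(e.symm ▸ hz : z ∈ s ∘ m ⁻¹' C ∩ K).1, hz'⟩

theorem continuousOn_biUnion_of_finite {ι Z W : Type*} [TopologicalSpace Z] [TopologicalSpace W]
    {s : Z → W} {F : Set ι} (hF : F.Finite) {C : ι → Set Z} (hC : ∀ i ∈ F, IsClosed (C i))
    (hs : ∀ i ∈ F, ContinuousOn s (C i)) : ContinuousOn s (⋃ i ∈ F, C i) := by
  rw [Set.biUnion_eq_iUnion]
  have := hF.to_subtype
  exact (locallyFinite_of_finite _).continuousOn_iUnion (fun i => hC i i.2) fun i => hs i i.2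

open Metric in
theorem mem_ball_or_mem_sphere {V : Type*} [PseudoMetricSpace V] {c z : V} {ε : ℝ}
    (hz : z ∈ closedBall c ε) : z ∈ ball c ε ∨ z ∈ sphere c ε :=
  (mem_closedBall.1 hz).lt_or_eq

open Metric Set in
/-- A decomposition of a space with a group action into freely permuted open cells, such that the
boundary of every cell lies in a finite union of closed cells of lower dimension. The closed cells
carry the quotient topology of balls, but the space need not have the weak topology. -/
structure EquivariantCells (Γ : Type*) (Y : Type*) [Group Γ] [MulAction Γ Y] [TopologicalSpace Y]
    {A : Type*} (V : A → Type*) [∀ a, NormedAddCommGroup (V a)] where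
  dim : A → ℕ
  map : ∀ a, V a → Y
  continuousOn : ∀ a, ContinuousOn (map a) (closedBall 0 1)
  exists_eq : ∀ y, ∃ (g : Γ) (a : A) (z : V a), z ∈ closedBall 0 1 ∧ y = g • map a z
  unique : ∀ {g g' : Γ} {a a' : A} {z : V a} {z' : V a'}, z ∈ ball 0 1 → z' ∈ ball 0 1 →
    g • map a z = g' • map a' z' →
    (⟨g, a, z⟩ : Γ × (Σ a, V a)) = ⟨g', a', z'⟩
  boundary : ∀ a, ∃ F : Set (Γ × A), F.Finite ∧ (∀ b ∈ F, dim b.2 < dim a) ∧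
    ∀ z ∈ sphere (0 : V a) 1, ∃ b ∈ F, ∃ w ∈ closedBall (0 : V b.2) 1, map a z = b.1 • map b.2 w

namespace EquivariantCells

open Metric Set

variable {Γ : Type*} {Y : Type*} [Group Γ] [MulAction Γ Y] [TopologicalSpace Y]
  {A : Type*} {V : A → Type*} [∀ a, NormedAddCommGroup (V a)]
  (𝒞 : EquivariantCells Γ Y V)

theorem exists_open_of_mem_closedBall (a : A) (z : V a) (hz : z ∈ closedBall 0 1) :
    ∃ (g : Γ) (b : A) (w : V b), w ∈ ball 0 1 ∧ 𝒞.map a z = g • 𝒞.map b w ∧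
      (z ∈ sphere 0 1 → 𝒞.dim b < 𝒞.dim a) := by
  induction h : 𝒞.dim a using Nat.strong_induction_on generalizing a with
  | _ n ih =>
    subst h
    rcases mem_ball_or_mem_sphere hz with hz1 | hz1
    · refine ⟨1, a, z, hz1, (one_smul _ _).symm, fun h => ?_⟩
      exact absurd (mem_sphere.1 h) (ne_of_lt (mem_ball.1 hz1))
    · obtain ⟨F, -, hFd, hF⟩ := 𝒞.boundary a
      obtain ⟨b, hb, w, hw, e⟩ := hF z hz1
      obtain ⟨g, c, x, hx, e', hd⟩ := ih _ (hFd b hb) b.2 w hw rfl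
      refine ⟨b.1 * g, c, x, hx, by rw [e, e', mul_smul], fun _ => ?_⟩
      rcases mem_ball_or_mem_sphere hw with hw1 | hw1
      · have heq : (⟨1, b.2, w⟩ : Γ × (Σ a, V a)) = ⟨g, c, x⟩ :=
          𝒞.unique hw1 hx (by rw [one_smul, e'])
        have hbc : b.2 = c := congrArg (fun p : Γ × (Σ a, V a) => p.2.1) heq
        exact hbc ▸ hFd b hb
      · exact (hd hw1).trans (hFd b hb)

theorem exists_open (y : Y) :
    ∃ p : Γ × (Σ a, V a), p.2.2 ∈ ball 0 1 ∧ y = p.1 • 𝒞.map p.2.1 p.2.2 := by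
  obtain ⟨g, a, z, hz, rfl⟩ := 𝒞.exists_eq y
  obtain ⟨h, b, w, hw, e, -⟩ := 𝒞.exists_open_of_mem_closedBall a z hz
  exact ⟨⟨g * h, b, w⟩, hw, by rw [e, mul_smul]⟩

/-- The open cell which contains a point, and its coordinate there. -/
noncomputable def loc (y : Y) : Γ × (Σ a, V a) := (𝒞.exists_open y).choose

theorem loc_mem (y : Y) : (𝒞.loc y).2.2 ∈ ball 0 1 := (𝒞.exists_open y).choose_spec.1

theorem loc_eq (y : Y) : y = (𝒞.loc y).1 • 𝒞.map (𝒞.loc y).2.1 (𝒞.loc y).2.2 :=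
  (𝒞.exists_open y).choose_spec.2

theorem loc_smul_map (g : Γ) {a : A} {z : V a} (hz : z ∈ ball 0 1) :
    𝒞.loc (g • 𝒞.map a z) = ⟨g, a, z⟩ :=
  𝒞.unique (𝒞.loc_mem _) hz (𝒞.loc_eq _).symm

theorem loc_map {a : A} {z : V a} (hz : z ∈ ball 0 1) : 𝒞.loc (𝒞.map a z) = ⟨1, a, z⟩ := by
  rw [← 𝒞.loc_smul_map 1 hz, one_smul]

theorem loc_smul (g : Γ) (y : Y) : 𝒞.loc (g • y) = ⟨g * (𝒞.loc y).1, (𝒞.loc y).2⟩ := by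
  conv_lhs => rw [𝒞.loc_eq y, ← mul_smul]
  exact 𝒞.loc_smul_map _ (𝒞.loc_mem y)

theorem dim_loc_lt {a : A} {z : V a} (hz : z ∈ sphere 0 1) :
    𝒞.dim (𝒞.loc (𝒞.map a z)).2.1 < 𝒞.dim a := by
  obtain ⟨g, b, w, hw, e, hd⟩ := 𝒞.exists_open_of_mem_closedBall a z (sphere_subset_closedBall hz)
  rw [e, 𝒞.loc_smul_map g hw]
  exact hd hz

section Section

variable {E : Type*} [MulAction Γ E] (ext : ∀ a, (V a → E) → V a → E) (e₀ : E)

/-- The function on the cell `a` obtained by extending successively over the cells: `ext a` extends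
a function from the boundary of the cell `a` to the cell. The junk value `e₀` is taken away from
the boundary. -/
noncomputable def cellSection (a : A) : V a → E :=
  ext a fun z =>
    if _h : 𝒞.dim (𝒞.loc (𝒞.map a z)).2.1 < 𝒞.dim a then
      (𝒞.loc (𝒞.map a z)).1 •
        cellSection (𝒞.loc (𝒞.map a z)).2.1 (𝒞.loc (𝒞.map a z)).2.2
    else e₀
termination_by 𝒞.dim a

/-- The equivariant function assembled from the functions `cellSection` on the cells. -/
noncomputable def assemble (y : Y) : E :=
  (𝒞.loc y).1 • 𝒞.cellSection ext e₀ (𝒞.loc y).2.1 (𝒞.loc y).2.2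

theorem assemble_smul (g : Γ) (y : Y) :
    𝒞.assemble ext e₀ (g • y) = g • 𝒞.assemble ext e₀ y := by
  rw [assemble, assemble, loc_smul, mul_smul]

theorem assemble_map {a : A} {z : V a} (hz : z ∈ ball 0 1) :
    𝒞.assemble ext e₀ (𝒞.map a z) = 𝒞.cellSection ext e₀ a z := by
  rw [assemble, 𝒞.loc_map hz]
  exact one_smul _ _

theorem cellSection_eq (a : A) :
    ∃ φ : V a → E, 𝒞.cellSection ext e₀ a = ext a φ ∧
      EqOn φ (𝒞.assemble ext e₀ ∘ 𝒞.map a) (sphere 0 1) := by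
  refine ⟨_, by rw [cellSection], fun z hz => ?_⟩
  simp only [dif_pos (𝒞.dim_loc_lt hz)]
  rfl

variable {ext e₀}

theorem proj_assemble {p : E → Y} (hp : ∀ (g : Γ) e, p (g • e) = g • p e) {y : Y}
    (h : ∀ z ∈ closedBall (0 : V (𝒞.loc y).2.1) 1,
      p (𝒞.cellSection ext e₀ (𝒞.loc y).2.1 z) = 𝒞.map (𝒞.loc y).2.1 z) :
    p (𝒞.assemble ext e₀ y) = y := by
  conv_rhs => rw [𝒞.loc_eq y]
  rw [assemble, hp, h _ (ball_subset_closedBall (𝒞.loc_mem _))]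

variable [TopologicalSpace E] [T2Space Y] [∀ a, ProperSpace (V a)] [ContinuousConstSMul Γ Y]
  [ContinuousConstSMul Γ E]

theorem continuousOn_iUnion_of_finite {s : Y → E}
    (hs : ∀ (g : Γ) y, s (g • y) = g • s y) {F : Set (Γ × A)} (hF : F.Finite)
    (h : ∀ b ∈ F, ContinuousOn (s ∘ 𝒞.map b.2) (closedBall 0 1)) :
    ContinuousOn s (⋃ b ∈ F, (fun z => b.1 • 𝒞.map b.2 z) '' closedBall 0 1) := by
  have hm : ∀ b : Γ × A, ContinuousOn (fun z => b.1 • 𝒞.map b.2 z) (closedBall 0 1) :=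
    fun b => (𝒞.continuousOn b.2).const_smul b.1
  refine continuousOn_biUnion_of_finite hF (fun b _ =>
    ((isCompact_closedBall _ _).image_of_continuousOn (hm b)).isClosed) fun b hb => ?_
  refine continuousOn_image_of_isCompact (isCompact_closedBall _ _) (hm b) ?_
  have hsmul : (s ∘ fun z => b.1 • 𝒞.map b.2 z) = fun z => b.1 • (s ∘ 𝒞.map b.2) z :=
    funext fun z => hs _ _
  rw [hsmul]
  exact (h b hb).const_smul b.1

theorem continuousOn_sphere {s : Y → E} (hs : ∀ (g : Γ) y, s (g • y) = g • s y) {a : A}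
    (h : ∀ b, 𝒞.dim b < 𝒞.dim a → ContinuousOn (s ∘ 𝒞.map b) (closedBall 0 1)) :
    ContinuousOn (s ∘ 𝒞.map a) (sphere 0 1) := by
  obtain ⟨F, hF, hFd, hFb⟩ := 𝒞.boundary a
  refine (𝒞.continuousOn_iUnion_of_finite hs hF fun b hb => h b.2 (hFd b hb)).comp
    ((𝒞.continuousOn a).mono sphere_subset_closedBall) fun z hz => ?_
  obtain ⟨b, hb, w, hw, e⟩ := hFb z hz
  exact mem_biUnion hb ⟨w, hw, e.symm⟩

theorem exists_equivariant_section [Nonempty E] {p : E → Y}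
    (hp : ∀ (g : Γ) e, p (g • e) = g • p e) (Q : ∀ a, (V a → E) → Prop)
    (hext : ∀ (a : A) (φ : V a → E), ContinuousOn φ (sphere 0 1) →
      (∀ z ∈ sphere (0 : V a) 1, p (φ z) = 𝒞.map a z) →
      ∃ ψ : V a → E, ContinuousOn ψ (closedBall 0 1) ∧
        (∀ z ∈ closedBall (0 : V a) 1, p (ψ z) = 𝒞.map a z) ∧ EqOn ψ φ (sphere 0 1) ∧ Q a ψ) :
    ∃ s : Y → E, (∀ y, p (s y) = y) ∧ (∀ (g : Γ) y, s (g • y) = g • s y) ∧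
      ∀ a, ContinuousOn (s ∘ 𝒞.map a) (closedBall 0 1) ∧
        ∃ ψ : V a → E, EqOn (s ∘ 𝒞.map a) ψ (closedBall 0 1) ∧ Q a ψ := by
  choose! ext hcont hproj hsphere hQ using hext
  let e₀ : E := Classical.arbitrary E
  let S := 𝒞.cellSection ext e₀
  let s := 𝒞.assemble ext e₀
  have hs : ∀ (g : Γ) y, s (g • y) = g • s y := 𝒞.assemble_smul ext e₀
  have hcell : ∀ n a, 𝒞.dim a = n → ContinuousOn (s ∘ 𝒞.map a) (closedBall 0 1) ∧
      (∀ z ∈ closedBall (0 : V a) 1, p (S a z) = 𝒞.map a z) ∧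
      EqOn (s ∘ 𝒞.map a) (S a) (closedBall 0 1) ∧ Q a (S a) := by
    intro n
    induction n using Nat.strong_induction_on with
    | _ n ih =>
      rintro a rfl
      obtain ⟨φ, hSφ, hφs⟩ := 𝒞.cellSection_eq ext e₀ a
      have hφ : ContinuousOn φ (sphere 0 1) :=
        (𝒞.continuousOn_sphere hs fun b hb => (ih _ hb b rfl).1).congr hφs
      have hφp : ∀ z ∈ sphere (0 : V a) 1, p (φ z) = 𝒞.map a z := fun z hz =>
        (congrArg p (hφs hz)).trans (𝒞.proj_assemble hp (ih _ (𝒞.dim_loc_lt hz) _ rfl).2.1)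
      have hS : S a = ext a φ := hSφ
      have hsS : EqOn (s ∘ 𝒞.map a) (S a) (closedBall 0 1) := by
        intro z hz
        rcases mem_ball_or_mem_sphere hz with hz1 | hz1
        · exact 𝒞.assemble_map ext e₀ hz1
        · rw [hS, hsphere a φ hφ hφp hz1, hφs hz1]
      exact ⟨(hS ▸ hcont a φ hφ hφp).congr hsS, hS ▸ hproj a φ hφ hφp, hsS, hS ▸ hQ a φ hφ hφp⟩
  exact ⟨s, fun y => 𝒞.proj_assemble hp (hcell _ _ rfl).2.1, hs, fun a =>
    ⟨(hcell _ a rfl).1, S a, (hcell _ a rfl).2.2⟩⟩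

end Section

end EquivariantCells

open Topology (CWComplex RelCWComplex)

/-- The cells of all dimensions of a space with a CW structure. -/
abbrev CWCell (X : Type*) [TopologicalSpace X] [CWComplex (Set.univ : Set X)] :=
  Σ n, RelCWComplex.cell (Set.univ : Set X) n

namespace CWCell

open Metric Set

variable {X : Type*} [TopologicalSpace X] [CWComplex (univ : Set X)]

/-- The characteristic map of a cell. Only its values on the closed unit ball are meaningful. -/
def charMap (a : CWCell X) : (Fin a.1 → ℝ) → X := RelCWComplex.map a.1 a.2

theorem continuousOn_charMap (a : CWCell X) : ContinuousOn (charMap a) (closedBall 0 1) :=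
  RelCWComplex.continuousOn a.1 a.2

theorem exists_eq_charMap (x : X) :
    ∃ (a : CWCell X) (z : Fin a.1 → ℝ), z ∈ closedBall 0 1 ∧ x = charMap a z := by
  have h : x ∈ ⋃ (n : ℕ) (j : RelCWComplex.cell (univ : Set X) n),
      RelCWComplex.closedCell n j := by
    rw [CWComplex.union]
    trivial
  simp only [mem_iUnion] at h
  obtain ⟨n, j, z, hz, rfl⟩ := h
  exact ⟨⟨n, j⟩, z, hz, rfl⟩

theorem charMap_injective {a b : CWCell X} {z : Fin a.1 → ℝ} {w : Fin b.1 → ℝ}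
    (hz : z ∈ ball 0 1) (hw : w ∈ ball 0 1) (h : charMap a z = charMap b w) :
    (⟨a, z⟩ : Σ a : CWCell X, Fin a.1 → ℝ) = ⟨b, w⟩ := by
  obtain rfl : a = b := by
    by_contra hne
    exact disjoint_left.1 (RelCWComplex.disjoint_openCell_of_ne (C := (univ : Set X)) hne)
      ⟨z, hz, rfl⟩ ⟨w, hw, h.symm⟩
  have hs := RelCWComplex.source_eq (C := (univ : Set X)) a.1 a.2
  obtain rfl : z = w :=
    (RelCWComplex.map (C := (univ : Set X)) a.1 a.2).injOn (hs ▸ hz) (hs ▸ hw) h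
  rfl

theorem exists_finite_boundary (a : CWCell X) : ∃ F : Set (CWCell X), F.Finite ∧
    (∀ b ∈ F, b.1 < a.1) ∧ ∀ z ∈ sphere (0 : Fin a.1 → ℝ) 1, ∃ b ∈ F,
      ∃ w ∈ closedBall (0 : Fin b.1 → ℝ) 1, charMap a z = charMap b w := by
  obtain ⟨J, hJ⟩ := CWComplex.mapsTo (C := (univ : Set X)) a.1 a.2
  refine ⟨(((Finset.range a.1).sigma J : Finset (CWCell X)) : Set (CWCell X)),
    Finset.finite_toSet _, fun b hb => ?_, fun z hz => ?_⟩
  · exact Finset.mem_range.1 (Finset.mem_sigma.1 (Finset.mem_coe.1 hb)).1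
  · have h := hJ hz
    simp only [mem_iUnion] at h
    obtain ⟨m, hm, j, hj, w, hw, e⟩ := h
    exact ⟨⟨m, j⟩, Finset.mem_coe.2 (Finset.mem_sigma.2 ⟨Finset.mem_range.2 hm, hj⟩), w, hw,
      e.symm⟩

variable (X) in
/-- A CW complex as an instance of `EquivariantCells`, with the trivial action. -/
def equivariantCells [MulAction Unit X] :
    EquivariantCells Unit X (fun a : CWCell X => Fin a.1 → ℝ) where
  dim a := a.1
  map := charMap
  continuousOn := continuousOn_charMap
  exists_eq x := by
    obtain ⟨a, z, hz, e⟩ := exists_eq_charMap x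
    exact ⟨1, a, z, hz, e.trans (one_smul Unit _).symm⟩
  unique {g g' a a' z z'} hz hz' h := by
    cases charMap_injective hz hz' (((one_smul Unit _).symm.trans h).trans (one_smul Unit _))
    rfl
  boundary a := by
    obtain ⟨F, hF, hFd, hFb⟩ := exists_finite_boundary a
    refine ⟨Prod.mk () '' F, hF.image _, ?_, fun z hz => ?_⟩
    · rintro _ ⟨b, hb, rfl⟩
      exact hFd b hb
    · obtain ⟨b, hb, w, hw, e⟩ := hFb z hz
      exact ⟨⟨(), b⟩, ⟨b, hb, rfl⟩, w, hw, e.trans (one_smul Unit _).symm⟩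

variable [T2Space X]

theorem isClosed_image_closedBall (a : CWCell X) : IsClosed (charMap a '' closedBall 0 1) :=
  RelCWComplex.isClosed_closedCell

theorem isClosed_of_inter_closedCell {S : Set X}
    (h : ∀ a : CWCell X, IsClosed (S ∩ charMap a '' closedBall 0 1)) : IsClosed S :=
  (CWComplex.closed (univ : Set X) _ (subset_univ _)).2 fun n j => h ⟨n, j⟩

theorem continuous_of_comp_charMap {E : Type*} [TopologicalSpace E] {s : X → E}
    (hs : ∀ a : CWCell X, ContinuousOn (s ∘ charMap a) (closedBall 0 1)) : Continuous s := by
  refine continuous_iff_isClosed.2 fun C hC => isClosed_of_inter_closedCell fun a => ?_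
  obtain ⟨D, hD, e⟩ := continuousOn_iff_isClosed.1
    (continuousOn_image_of_isCompact (isCompact_closedBall _ _) (continuousOn_charMap a) (hs a))
    C hC
  rw [e]
  exact hD.inter (isClosed_image_closedBall a)

variable (X) in
theorem locallyPathConnectedSpace : LocallyPathConnectedSpace X := by
  have : ∀ a : CWCell X, LocallyPathConnectedSpace (closedBall (0 : Fin a.1 → ℝ) 1) :=
    fun a => (convex_closedBall _ _).locallyPathConnectedSpace
  let f : (Σ a : CWCell X, closedBall (0 : Fin a.1 → ℝ) 1) → X := fun p => charMap p.1 p.2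
  have hf : Continuous f := continuous_sigma fun a =>
    continuousOn_iff_continuous_domRestrict.1 (continuousOn_charMap a)
  refine Topology.IsQuotientMap.locallyPathConnectedSpace (f := f)
    (Topology.isQuotientMap_iff_isClosed.2 ⟨fun x => ?_, fun S =>
      ⟨fun h => h.preimage hf, fun h => isClosed_of_inter_closedCell fun a => ?_⟩⟩)
  · obtain ⟨a, z, hz, rfl⟩ := exists_eq_charMap x
    exact ⟨⟨a, z, hz⟩, rfl⟩
  · have : CompactSpace (closedBall (0 : Fin a.1 → ℝ) 1) :=
      isCompact_iff_compactSpace.1 (isCompact_closedBall _ _)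
    have hfa : Continuous fun z => f ⟨a, z⟩ := continuous_sigma_iff.1 hf a
    have hS : IsClosed ((fun z => f ⟨a, z⟩) ⁻¹' S) := isClosed_sigma_iff.1 h a
    convert (hS.isCompact.image hfa).isClosed using 1
    ext x
    constructor
    · rintro ⟨hx, z, hz, rfl⟩
      exact ⟨⟨z, hz⟩, hx, rfl⟩
    · rintro ⟨z, hz, rfl⟩
      exact ⟨hz, z, z.2, rfl⟩

theorem isClosed_of_subsingleton_inter_openCell {S : Set X}
    (hS : ∀ a : CWCell X, (S ∩ charMap a '' ball 0 1).Subsingleton) : IsClosed S := by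
  suffices h : ∀ n, ∀ a : CWCell X, a.1 = n → (S ∩ charMap a '' closedBall 0 1).Finite from
    isClosed_of_inter_closedCell fun a => (h _ a rfl).isClosed
  intro n
  induction n using Nat.strong_induction_on with
  | _ n ih =>
    rintro a rfl
    obtain ⟨F, hF, hFd, hFb⟩ := exists_finite_boundary a
    refine ((hS a).finite.union (hF.biUnion fun b hb => ih _ (hFd b hb) b rfl)).subset ?_
    rintro _ ⟨hxS, z, hz, rfl⟩
    rcases mem_ball_or_mem_sphere hz with hz1 | hz1
    · exact Or.inl ⟨hxS, z, hz1, rfl⟩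
    · obtain ⟨b, hb, w, hw, e⟩ := hFb z hz1
      exact Or.inr (mem_biUnion hb ⟨hxS, w, hw, e.symm⟩)

theorem finite_openCell_inter_nonempty {K : Set X} (hK : IsCompact K) :
    {a : CWCell X | (charMap a '' ball 0 1 ∩ K).Nonempty}.Finite := by
  set F := {a : CWCell X | (charMap a '' ball 0 1 ∩ K).Nonempty}
  rcases isEmpty_or_nonempty X with hX | hX
  · have : IsEmpty (CWCell X) := ⟨fun a => isEmptyElim (charMap a 0)⟩
    exact F.toFinite
  have hF : ∀ a ∈ F, ∃ x, x ∈ charMap a '' ball 0 1 ∧ x ∈ K := fun a ha => ha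
  choose! x hx hxK using hF
  have hcell : ∀ a ∈ F, ∀ b : CWCell X, x a ∈ charMap b '' ball 0 1 → a = b := by
    rintro a ha b ⟨w, hw, e⟩
    obtain ⟨z, hz, ez⟩ := hx a ha
    exact congrArg Sigma.fst (charMap_injective hz hw (ez.trans e.symm))
  have hclosed : ∀ S ⊆ x '' F, IsClosed S := by
    refine fun S hS => isClosed_of_subsingleton_inter_openCell fun b => ?_
    rintro y ⟨hy, hyb⟩ y' ⟨hy', hyb'⟩
    obtain ⟨a, ha, rfl⟩ := hS hy
    obtain ⟨a', ha', rfl⟩ := hS hy'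
    rw [hcell a ha b hyb, hcell a' ha' b hyb']
  have hdiscrete : DiscreteTopology (x '' F) := discreteTopology_iff_forall_isClosed.2 fun S => by
    rw [← preimage_image_eq S Subtype.val_injective]
    exact (hclosed _ (Subtype.coe_image_subset _ S)).preimage continuous_subtype_val
  refine Finite.of_finite_image (f := x) ?_ fun a ha b hb h => hcell a ha b (h ▸ hx b hb)
  exact (hK.of_isClosed_subset (hclosed _ subset_rfl) (image_subset_iff.2 hxK)).finite
    (isDiscrete_iff_discreteTopology.2 hdiscrete)

theorem exists_section {E : Type*} [TopologicalSpace E] [Nonempty E] {p : E → X}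
    (Q : ∀ a : CWCell X, ((Fin a.1 → ℝ) → E) → Prop)
    (hext : ∀ (a : CWCell X) (φ : (Fin a.1 → ℝ) → E), ContinuousOn φ (sphere 0 1) →
      (∀ z ∈ sphere (0 : Fin a.1 → ℝ) 1, p (φ z) = charMap a z) →
      ∃ ψ : (Fin a.1 → ℝ) → E, ContinuousOn ψ (closedBall 0 1) ∧
        (∀ z ∈ closedBall (0 : Fin a.1 → ℝ) 1, p (ψ z) = charMap a z) ∧
        EqOn ψ φ (sphere 0 1) ∧ Q a ψ) :
    ∃ s : X → E, Continuous s ∧ (∀ x, p (s x) = x) ∧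
      ∀ a, ∃ ψ : (Fin a.1 → ℝ) → E, EqOn (s ∘ charMap a) ψ (closedBall 0 1) ∧ Q a ψ := by
  let : MulAction Unit X :=
    { smul := fun _ x => x, one_smul := fun _ => rfl, mul_smul := fun _ _ _ => rfl }
  let : MulAction Unit E :=
    { smul := fun _ z => z, one_smul := fun _ => rfl, mul_smul := fun _ _ _ => rfl }
  have : ContinuousConstSMul Unit X := ⟨fun _ => continuous_id⟩
  have : ContinuousConstSMul Unit E := ⟨fun _ => continuous_id⟩
  obtain ⟨s, hs, -, hscell⟩ :=
    (equivariantCells X).exists_equivariant_section (p := p) (fun _ _ => rfl) Q hext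
  exact ⟨s, continuous_of_comp_charMap fun a => (hscell a).1, hs, fun a => (hscell a).2⟩

end CWCell

section RadialSum

open Metric

variable {W M : Type*} [NormedAddCommGroup W] [NormedSpace ℝ W] [NormedAddCommGroup M]
  [NormedSpace ℝ M]

theorem continuous_max_smul_of_sphere {φ : W → M} (hφ : ContinuousOn φ (sphere 0 1)) :
    Continuous fun z => max 0 (2 * ‖z‖ - 1) • φ (‖z‖⁻¹ • z) := by
  refine continuous_iff_continuousAt.2 fun z => ?_
  rcases eq_or_ne z 0 with rfl | hz
  · refine continuousAt_const (y := (0 : M)).congr ?_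
    filter_upwards [ball_mem_nhds (0 : W) one_half_pos] with y hy
    rw [max_eq_left (by linarith [mem_ball_zero_iff.1 hy]), zero_smul]
  · have hmax : Continuous fun z : W => max 0 (2 * ‖z‖ - 1) := by fun_prop
    exact hmax.continuousAt.smul ((hφ.comp continuousOn_norm_inv_smul
      fun z hz => norm_inv_smul_mem_sphere hz).continuousAt (isOpen_compl_singleton.mem_nhds hz))

end RadialSum

namespace CWCell

open Metric Set

variable {X : Type*} [TopologicalSpace X] [CWComplex (univ : Set X)]

theorem exists_mem_ball_eq_charMap (x : X) :
    ∃ (a : CWCell X) (z : Fin a.1 → ℝ), z ∈ ball 0 1 ∧ x = charMap a z := by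
  have h : x ∈ ⋃ (n : ℕ) (j : RelCWComplex.cell (univ : Set X) n),
      RelCWComplex.openCell n j := by
    rw [CWComplex.iUnion_openCell_eq_complex]
    trivial
  simp only [mem_iUnion] at h
  obtain ⟨n, j, z, hz, rfl⟩ := h
  exact ⟨⟨n, j⟩, z, hz, rfl⟩

theorem exists_lt_charMap_norm_inv_smul_eq (b : CWCell X) {z : Fin b.1 → ℝ} (hz : z ≠ 0) :
    ∃ c : CWCell X, c.1 < b.1 ∧ ∃ w ∈ closedBall (0 : Fin c.1 → ℝ) 1,
      charMap b (‖z‖⁻¹ • z) = charMap c w := by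
  obtain ⟨F, -, hFd, hFb⟩ := exists_finite_boundary b
  obtain ⟨c, hc, w, hw, e⟩ := hFb _ (norm_inv_smul_mem_sphere hz)
  exact ⟨c, hFd c hc, w, hw, e⟩

/-- A map on a CW complex collapses collars if it is constant along the radii of the outer half of
every closed cell. -/
def IsCollarCollapsing {Y : Type*} (k : X → Y) : Prop :=
  ∀ a : CWCell X, ∀ z ∈ closedBall (0 : Fin a.1 → ℝ) 1, 1 / 2 ≤ ‖z‖ →
    k (charMap a z) = k (charMap a (‖z‖⁻¹ • z))

variable (X) in
theorem exists_homotopic_id_isCollarCollapsing [T2Space X] :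
    ∃ k : C(X, X), (ContinuousMap.id X).Homotopic k ∧ IsCollarCollapsing k := by
  rcases isEmpty_or_nonempty X with hX | ⟨⟨x₀⟩⟩
  · exact ⟨.id X, .refl _, fun a => isEmptyElim (charMap a 0)⟩
  have : Nonempty C(I, X) := ⟨.const _ x₀⟩
  obtain ⟨h, hh, hh0, hhQ⟩ := exists_section (X := X) (E := C(I, X)) (p := fun ω => ω 0)
    (fun a ψ => ∀ z ∈ closedBall (0 : Fin a.1 → ℝ) 1, 1 / 2 ≤ ‖z‖ →
      ψ z 1 = ψ (‖z‖⁻¹ • z) 1)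
    (fun a φ hφ hφ0 => by
      obtain ⟨ψ, hψ, hψ0, hψφ, hψ1⟩ := exists_extend_paths_of_sphere (φ := fun z t => φ z t)
        (continuousOn_charMap a)
        (continuous_eval.comp_continuousOn ((hφ.comp continuousOn_fst fun q hq => hq.1).prodMk
          continuousOn_snd)) hφ0
      exact ⟨ψ, hψ.continuousOn, hψ0, fun z hz => ContinuousMap.ext (hψφ z hz), hψ1⟩)
  let k : C(X, X) := ⟨fun x => h x 1, by fun_prop⟩
  let F : (ContinuousMap.id X).Homotopy k :=
    { toFun := fun q => h q.2 q.1
      continuous_toFun := by fun_prop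
      map_zero_left := hh0
      map_one_left := fun x => rfl }
  refine ⟨k, ⟨F⟩, fun a z hz hz2 => ?_⟩
  obtain ⟨ψ, hψ, hψ1⟩ := hhQ a
  have hz0 : z ≠ 0 := by
    rintro rfl
    norm_num at hz2
  have h1 : h (charMap a z) = ψ z := hψ hz
  have h2 : h (charMap a (‖z‖⁻¹ • z)) = ψ (‖z‖⁻¹ • z) :=
    hψ (sphere_subset_closedBall (norm_inv_smul_mem_sphere hz0))
  change h (charMap a z) 1 = h (charMap a (‖z‖⁻¹ • z)) 1
  rw [h1, h2, hψ1 z hz hz2]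

theorem exists_continuous_radial_sum [T2Space X] {M : Type*} [NormedAddCommGroup M]
    [NormedSpace ℝ M] {B : ∀ b : CWCell X, (Fin b.1 → ℝ) → M} (hB : ∀ b, Continuous (B b))
    (hB0 : ∀ b : CWCell X, ∀ z ∈ sphere (0 : Fin b.1 → ℝ) 1, B b z = 0) :
    ∃ R : X → M, Continuous R ∧ ∀ b : CWCell X, ∀ z ∈ closedBall (0 : Fin b.1 → ℝ) 1,
      R (charMap b z) = max 0 (2 * ‖z‖ - 1) • R (charMap b (‖z‖⁻¹ • z)) + B b z := by
  rcases isEmpty_or_nonempty X with hX | hX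
  · exact ⟨0, continuous_zero, fun a => isEmptyElim (charMap a 0)⟩
  obtain ⟨s, hs, -, hsQ⟩ := exists_section (X := X) (E := X × M) (p := Prod.fst)
    (fun b ψ => ∀ z ∈ closedBall (0 : Fin b.1 → ℝ) 1,
      (ψ z).2 = max 0 (2 * ‖z‖ - 1) • (ψ (‖z‖⁻¹ • z)).2 + B b z)
    (fun b φ hφ hφp => by
      have hval : ∀ z ∈ sphere (0 : Fin b.1 → ℝ) 1,
          max 0 (2 * ‖z‖ - 1) • (φ (‖z‖⁻¹ • z)).2 + B b z = (φ z).2 := by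
        intro z hz
        rw [hB0 b z hz, mem_sphere_zero_iff_norm.1 hz]
        norm_num
      refine ⟨fun z => (charMap b z, max 0 (2 * ‖z‖ - 1) • (φ (‖z‖⁻¹ • z)).2 + B b z),
        (continuousOn_charMap b).prodMk
          ((continuous_max_smul_of_sphere (continuous_snd.comp_continuousOn hφ)).add
            (hB b)).continuousOn,
        fun z _ => rfl, fun z hz => Prod.ext (hφp z hz).symm (hval z hz), fun z hz => ?_⟩
      rcases eq_or_ne z 0 with rfl | hz0
      · simp
      · exact congrArg₂ (· + ·) (congrArg _ (hval _ (norm_inv_smul_mem_sphere hz0)).symm) rfl)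
  refine ⟨fun x => (s x).2, continuous_snd.comp hs, fun b z hz => ?_⟩
  obtain ⟨ψ, hψ, hψQ⟩ := hsQ b
  have hz' : ‖z‖⁻¹ • z ∈ closedBall 0 1 := by
    rcases eq_or_ne z 0 with rfl | hz0
    · simp
    · exact sphere_subset_closedBall (norm_inv_smul_mem_sphere hz0)
  have h1 : s (charMap b z) = ψ z := hψ hz
  have h2 : s (charMap b (‖z‖⁻¹ • z)) = ψ (‖z‖⁻¹ • z) := hψ hz'
  beta_reduce
  rw [h1, h2, hψQ z hz]

/-- A coordinate on the open star of the cell `a`: a cone coordinate `(1 - ‖z‖) • (z, 1)` on `a`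
itself, extended radially over the outer halves of the cells attached to it. The star is the set
where the second component is positive. -/
structure IsStarCoordinate (a : CWCell X) (R : X → (Fin a.1 → ℝ) × ℝ) : Prop where
  continuous : Continuous R
  apply_charMap_self : ∀ z ∈ closedBall (0 : Fin a.1 → ℝ) 1, R (charMap a z) =
    max 0 (2 * ‖z‖ - 1) • R (charMap a (‖z‖⁻¹ • z)) + (1 - ‖z‖) • (z, 1)
  apply_charMap_of_ne : ∀ b : CWCell X, b ≠ a → ∀ z ∈ closedBall (0 : Fin b.1 → ℝ) 1,
    R (charMap b z) = max 0 (2 * ‖z‖ - 1) • R (charMap b (‖z‖⁻¹ • z))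

theorem exists_isStarCoordinate [T2Space X] (a : CWCell X) : ∃ R, IsStarCoordinate a R := by
  classical
  let B : ∀ b : CWCell X, (Fin b.1 → ℝ) → (Fin a.1 → ℝ) × ℝ := fun b z =>
    if h : b = a then (1 - ‖z‖) • (h ▸ z, 1) else 0
  have hBa : ∀ z, B a z = (1 - ‖z‖) • (z, 1) := fun z => dif_pos rfl
  have hBb : ∀ b ≠ a, ∀ z, B b z = 0 := fun b hb z => dif_neg hb
  have hB : ∀ b, Continuous (B b) := fun b => by
    rcases eq_or_ne b a with rfl | hb
    · rw [funext hBa]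
      fun_prop
    · rw [funext (hBb b hb)]
      exact continuous_const
  have hB0 : ∀ b : CWCell X, ∀ z ∈ sphere (0 : Fin b.1 → ℝ) 1, B b z = 0 := fun b z hz => by
    rcases eq_or_ne b a with rfl | hb
    · rw [hBa, mem_sphere_zero_iff_norm.1 hz, sub_self, zero_smul]
    · exact hBb b hb z
  obtain ⟨R, hR, hRB⟩ := exists_continuous_radial_sum hB hB0
  exact ⟨R, hR, fun z hz => by rw [hRB a z hz, hBa],
    fun b hb z hz => by rw [hRB b z hz, hBb b hb, add_zero]⟩

/-- The retraction onto the cell `a` of its open star, in terms of a star coordinate `R`. -/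
noncomputable def starRetraction {a : CWCell X} (R : X → (Fin a.1 → ℝ) × ℝ) (y : X) : Fin a.1 → ℝ :=
  (R y).2⁻¹ • (R y).1

namespace IsStarCoordinate

variable {a : CWCell X} {R : X → (Fin a.1 → ℝ) × ℝ}

theorem apply_charMap_eq_zero (hR : IsStarCoordinate a R) (b : CWCell X) (hb : b ≠ a)
    (hba : b.1 ≤ a.1) (z : Fin b.1 → ℝ) (hz : z ∈ closedBall 0 1) : R (charMap b z) = 0 := by
  rw [hR.apply_charMap_of_ne b hb z hz]
  rcases eq_or_ne z 0 with rfl | hz0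
  · simp
  obtain ⟨c, hcb, w, hw, e⟩ := exists_lt_charMap_norm_inv_smul_eq b hz0
  have hca : c ≠ a := by
    rintro rfl
    exact hcb.not_ge hba
  rw [e, hR.apply_charMap_eq_zero c hca (hcb.le.trans hba) w hw, smul_zero]
termination_by b.1

theorem apply_charMap (hR : IsStarCoordinate a R) {z : Fin a.1 → ℝ} (hz : z ∈ closedBall 0 1) :
    R (charMap a z) = (1 - ‖z‖) • (z, 1) := by
  rw [hR.apply_charMap_self z hz]
  rcases eq_or_ne z 0 with rfl | hz0
  · simp
  obtain ⟨c, hca, w, hw, e⟩ := exists_lt_charMap_norm_inv_smul_eq a hz0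
  rw [e, hR.apply_charMap_eq_zero c (fun h => hca.ne (congrArg Sigma.fst h)) hca.le w hw,
    smul_zero, zero_add]

theorem continuousOn_starRetraction (hR : IsStarCoordinate a R) :
    ContinuousOn (starRetraction R) {y | 0 < (R y).2} := by
  have := hR.continuous
  exact ContinuousOn.smul (f := fun y => (R y).2⁻¹)
    (ContinuousOn.inv₀ (by fun_prop) fun y hy => ne_of_gt hy) (by fun_prop)

theorem starRetraction_charMap (hR : IsStarCoordinate a R) {z : Fin a.1 → ℝ}
    (hz : z ∈ ball 0 1) : starRetraction R (charMap a z) = z := by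
  have hpos : 0 < 1 - ‖z‖ := sub_pos.2 (mem_ball_zero_iff.1 hz)
  rw [starRetraction, hR.apply_charMap (ball_subset_closedBall hz)]
  simp only [Prod.smul_mk, smul_eq_mul, mul_one]
  rw [smul_smul, inv_mul_cancel₀ hpos.ne', one_smul]

theorem starRetraction_mem_ball_and_apply_eq {Y : Type*} {k : X → Y} (hk : IsCollarCollapsing k)
    (hR : IsStarCoordinate a R) (b : CWCell X) (z : Fin b.1 → ℝ) (hz : z ∈ closedBall 0 1)
    (hpos : 0 < (R (charMap b z)).2) : starRetraction R (charMap b z) ∈ ball 0 1 ∧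
      k (charMap b z) = k (charMap a (starRetraction R (charMap b z))) := by
  rcases eq_or_ne b a with rfl | hb
  · have hz1 : z ∈ ball 0 1 := by
      rw [hR.apply_charMap hz] at hpos
      simpa using hpos
    rw [hR.starRetraction_charMap hz1]
    exact ⟨hz1, rfl⟩
  have hRz := hR.apply_charMap_of_ne b hb z hz
  have hz1 : 1 / 2 < ‖z‖ := by
    by_contra! hz1
    rw [hRz, max_eq_left (by linarith), zero_smul] at hpos
    exact lt_irrefl _ hpos
  have hm : 0 < 2 * ‖z‖ - 1 := by linarith
  rw [max_eq_right hm.le] at hRz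
  have hr : starRetraction R (charMap b z) = starRetraction R (charMap b (‖z‖⁻¹ • z)) := by
    simp only [starRetraction, hRz, Prod.smul_fst, Prod.smul_snd, smul_eq_mul, smul_smul]
    congr 1
    field_simp
  obtain ⟨c, hcb, w, hw, e⟩ :=
    exists_lt_charMap_norm_inv_smul_eq b (norm_pos_iff.1 (by linarith : 0 < ‖z‖))
  have hpos' : 0 < (R (charMap c w)).2 := by
    rw [hRz, e] at hpos
    exact pos_of_mul_pos_right hpos hm.le
  rw [hr, hk b z hz hz1.le, e]
  exact starRetraction_mem_ball_and_apply_eq hk hR c w hw hpos'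
termination_by b.1

end IsStarCoordinate

theorem IsCollarCollapsing.exists_eq_comp_charMap [T2Space X] {Y : Type*} {k : X → Y}
    (hk : IsCollarCollapsing k) (x : X) :
    ∃ (a : CWCell X) (V : Set X) (r : X → Fin a.1 → ℝ), IsOpen V ∧ x ∈ V ∧ ContinuousOn r V ∧
      MapsTo r V (ball 0 1) ∧ ∀ y ∈ V, k y = k (charMap a (r y)) := by
  obtain ⟨a, z, hz, rfl⟩ := exists_mem_ball_eq_charMap x
  obtain ⟨R, hR⟩ := exists_isStarCoordinate a
  have h : ∀ y, 0 < (R y).2 →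
      starRetraction R y ∈ ball 0 1 ∧ k y = k (charMap a (starRetraction R y)) := by
    intro y hy
    obtain ⟨b, w, hw, rfl⟩ := exists_eq_charMap y
    exact hR.starRetraction_mem_ball_and_apply_eq hk b w hw hy
  refine ⟨a, {y | 0 < (R y).2}, starRetraction R,
    isOpen_lt continuous_const (continuous_snd.comp hR.continuous), ?_,
    hR.continuousOn_starRetraction, fun y hy => (h y hy).1, fun y hy => (h y hy).2⟩
  rw [mem_ofPred_eq, hR.apply_charMap (ball_subset_closedBall hz)]
  simpa using mem_ball_zero_iff.1 hz

end CWCell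

section PathHomotopy

variable {X Y A : Type*} [TopologicalSpace X] [TopologicalSpace Y] [TopologicalSpace A] {y z : X}

theorem homotopic_of_map_homotopic {k : C(X, X)} (hk : (ContinuousMap.id X).Homotopic k)
    {p q : Path y z} (h : (p.map k.continuous).Homotopic (q.map k.continuous)) :
    p.Homotopic q := by
  obtain ⟨F⟩ := hk
  have hp := Path.Homotopic.Quotient.eq.2 (Path.Homotopic.map_trans_evalAt F p)
  have hq := Path.Homotopic.Quotient.eq.2 (Path.Homotopic.map_trans_evalAt F q)
  rw [Path.Homotopic.Quotient.mk_trans, Path.Homotopic.Quotient.mk_trans] at hp hq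
  rw [Path.Homotopic.Quotient.eq.2 h] at hp
  have hpq := congrArg
    (fun δ => δ.trans (Path.Homotopic.Quotient.mk (F.evalAt z)).symm) (hp.trans hq.symm)
  simp only [Path.Homotopic.Quotient.trans_assoc, Path.Homotopic.Quotient.trans_symm,
    Path.Homotopic.Quotient.trans_refl] at hpq
  exact Path.Homotopic.Quotient.eq.1 hpq

theorem map_homotopic_map_of_factorsThrough [SimplyConnectedSpace A] {k : X → Y}
    (hk : Continuous k) {V : Set X} {r : V → A} (hr : Continuous r) {j : A → Y}
    (hj : Continuous j) (hkj : ∀ x : V, k x = j (r x)) {p q : Path y z} (hp : ∀ t, p t ∈ V)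
    (hq : ∀ t, q t ∈ V) : (p.map hk).Homotopic (q.map hk) := by
  let y' : V := ⟨y, by simpa using hp 0⟩
  let z' : V := ⟨z, by simpa using hp 1⟩
  have hlift : ∀ p : Path y z, (∀ t, p t ∈ V) → ∃ P : Path (r y') (r z'),
      p.map hk = (P.map hj).cast (hkj y') (hkj z') := fun p hp => by
    let p' : Path y' z' :=
      { toFun := fun t => ⟨p t, hp t⟩
        source' := Subtype.ext p.source
        target' := Subtype.ext p.target }
    exact ⟨p'.map hr, Path.ext (funext fun t => hkj (p' t))⟩
  obtain ⟨P, hP⟩ := hlift p hp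
  obtain ⟨Q, hQ⟩ := hlift q hq
  rw [hP, hQ]
  exact ((SimplyConnectedSpace.paths_homotopic P Q).map ⟨j, hj⟩).pathCast (hkj y') (hkj z')

end PathHomotopy

variable (X : Type*) in
theorem CWCell.isSemilocallySimplyConnected [TopologicalSpace X] [CWComplex (Set.univ : Set X)]
    [T2Space X] : IsSemilocallySimplyConnected X := by
  obtain ⟨k, hkid, hk⟩ := exists_homotopic_id_isCollarCollapsing X
  intro x
  obtain ⟨a, V, r, hV, hxV, hr, hrV, hkr⟩ := hk.exists_eq_comp_charMap x
  have : ContractibleSpace (Metric.ball (0 : Fin a.1 → ℝ) 1) :=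
    (convex_ball _ _).contractibleSpace ⟨0, by simp⟩
  refine ⟨V, hV, hxV, fun y z p q hp hq => homotopic_of_map_homotopic hkid ?_⟩
  exact map_homotopic_map_of_factorsThrough k.continuous
    (r := fun y : V => (⟨r y, hrV y.2⟩ : Metric.ball (0 : Fin a.1 → ℝ) 1))
    (continuousOn_iff_continuous_domRestrict.1 hr |>.subtype_mk _)
    (j := fun z => k (charMap a z))
    (k.continuous.comp ((continuousOn_charMap a).comp_continuous continuous_subtype_val
      fun z => Metric.ball_subset_closedBall z.2))
    (fun y => hkr y y.2) hp hq

section HomotopyGroups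

theorem subsingleton_homotopyGroup_iff {X N : Type*} [TopologicalSpace X] {x : X} :
    Subsingleton (HomotopyGroup N X x) ↔
      ∀ f : GenLoop N X x, GenLoop.Homotopic f GenLoop.const := by
  constructor
  · intro h f
    exact Quotient.exact (Subsingleton.elim (α := HomotopyGroup N X x) ⟦f⟧ ⟦GenLoop.const⟧)
  · intro h
    refine ⟨fun a b => ?_⟩
    induction a using Quotient.inductionOn with | _ f =>
    induction b using Quotient.inductionOn with | _ g =>
    exact Quotient.sound ((h f).trans (h g).symm)

theorem ballToCube_cubeToBall {V : Type*} [NormedAddCommGroup V] {N : ℕ} (e : V ≃ᵢ (Fin N → ℝ))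
    (c : Fin N → I) : ballToCube e (cubeToBall e c) = c := by
  refine funext fun i => ?_
  change Set.projIcc 0 1 zero_le_one ((e (e.symm fun i => 2 * (c i : ℝ) - 1) i + 1) / 2) = c i
  rw [e.apply_symm_apply, sub_add_cancel, mul_div_cancel_left₀ _ two_ne_zero, Set.projIcc_val]

open Metric in
theorem exists_continuous_eqOn_sphere_of_contractibleSpace {Y W : Type*} [TopologicalSpace Y]
    [ContractibleSpace Y] [NormedAddCommGroup W] [NormedSpace ℝ W] {g : W → Y}
    (hg : ContinuousOn g (sphere 0 1)) : ∃ G : W → Y, Continuous G ∧ Set.EqOn G g (sphere 0 1) := by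
  obtain ⟨b, ⟨H⟩⟩ := id_nullhomotopic Y
  obtain ⟨G, hG, hGg⟩ := exists_extend_closedBall_of_homotopy (m := fun _ => b)
    (φ := fun z t => H (σ t, g z)) continuousOn_const
    (H.continuous.comp_continuousOn ((by fun_prop : ContinuousOn _ _).prodMk
      (hg.comp continuousOn_fst fun q hq => hq.1))) (fun z _ => by simp)
  exact ⟨G, hG, fun z hz => by simpa using hGg z hz⟩

open Metric in
theorem subsingleton_homotopyGroup_of_contractibleSpace {Y : Type*} [TopologicalSpace Y]
    [ContractibleSpace Y] (N : ℕ) (y : Y) : Subsingleton (π_ N Y y) := by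
  classical
  refine subsingleton_homotopyGroup_iff.2 fun f => ?_
  let e := IsometryEquiv.refl (Fin N → ℝ)
  have he : e 0 = 0 := rfl
  let g : ℝ × (Fin N → ℝ) → Y := fun w => if w.1 ≤ 0 then f (ballToCube e w.2) else y
  have hg : ContinuousOn g (sphere 0 1) := by
    refine ContinuousOn.if (fun w hw => ?_) (f.1.continuous.comp (by fun_prop)).continuousOn
      continuousOn_const
    have h0 : w.1 = 0 := frontier_le_subset_eq continuous_fst continuous_const hw.2
    refine f.2 _ (ballToCube_mem_boundary he (mem_sphere_zero_iff_norm.2 ?_))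
    exact (abs_fst_eq_one_or_norm_snd_eq_one hw.1).resolve_left (by norm_num [h0])
  obtain ⟨G, hG, hGg⟩ := exists_continuous_eqOn_sphere_of_contractibleSpace hg
  have hmem : ∀ (t : I) (c : Fin N → I),
      (|2 * (t : ℝ) - 1| = 1 ∨ c ∈ Cube.boundary (Fin N)) →
        (2 * (t : ℝ) - 1, cubeToBall e c) ∈ sphere (0 : ℝ × (Fin N → ℝ)) 1 := fun t c h => by
    refine mem_sphere_zero_prod.2 ?_
    rcases h with h | h
    · exact .inl ⟨mem_sphere_zero_iff_norm.2 h, cubeToBall_mem_closedBall he c⟩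
    · exact .inr ⟨two_mul_sub_one_mem_closedBall t, cubeToBall_mem_sphere he h⟩
  exact ⟨{
    toFun := fun q => G (2 * (q.1 : ℝ) - 1, cubeToBall e q.2)
    continuous_toFun := by fun_prop
    map_zero_left := fun c => (hGg (hmem 0 c (by norm_num))).trans
      ((if_pos (by norm_num)).trans (congrArg f (ballToCube_cubeToBall e c)))
    map_one_left := fun c => (hGg (hmem 1 c (by norm_num))).trans (if_neg (by norm_num))
    prop' := fun t c hc => (hGg (hmem t c (.inr hc))).trans
      ((ite_congr rfl (fun _ => (congrArg f (ballToCube_cubeToBall e c)).trans (f.2 c hc))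
        fun _ => rfl).trans ((ite_self _).trans (f.2 c hc).symm)) }⟩

end HomotopyGroups

section Covering

variable {E X : Type*} [TopologicalSpace E] [TopologicalSpace X] {p : E → X}

theorem exists_lift_closedBall (cov : IsCoveringMap p) {W : Type*} [NormedAddCommGroup W]
    [NormedSpace ℝ W] {f : W → X} (hf : ContinuousOn f (Metric.closedBall 0 1)) {e₀ : E}
    (he : p e₀ = f 0) : ∃ F : W → E, ContinuousOn F (Metric.closedBall 0 1) ∧
      (∀ z ∈ Metric.closedBall (0 : W) 1, p (F z) = f z) ∧ F 0 = e₀ := by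
  classical
  let B := Metric.closedBall (0 : W) 1
  have hB : Convex ℝ B := convex_closedBall _ _
  let z₀ : B := ⟨0, Metric.mem_closedBall_self zero_le_one⟩
  have : ContractibleSpace B := hB.contractibleSpace ⟨0, z₀.2⟩
  have : LocallyPathConnectedSpace B := hB.locallyPathConnectedSpace
  obtain ⟨F, ⟨hF0, hF⟩, -⟩ := cov.existsUnique_continuousMap_lifts
    ⟨fun z : B => f z, continuousOn_iff_continuous_domRestrict.1 hf⟩ z₀ e₀ he
  let F' : W → E := fun z => if h : z ∈ B then F ⟨z, h⟩ else e₀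
  have hF' : ∀ z (hz : z ∈ B), F' z = F ⟨z, hz⟩ := fun z hz => dif_pos hz
  refine ⟨F', ?_, fun z hz => ?_, (hF' 0 z₀.2).trans hF0⟩
  · rw [continuousOn_iff_continuous_domRestrict]
    exact F.continuous.congr fun z => (hF' z z.2).symm
  · rw [hF' z hz]
    exact congrFun hF _

theorem exists_lift_genLoop (cov : IsCoveringMap p) {r : ℕ} (hr : 2 ≤ r) {a : E}
    (f : GenLoop (Fin r) X (p a)) : ∃ g : GenLoop (Fin r) E a, ∀ y, p (g y) = f y := by
  have : NeZero r := ⟨by omega⟩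
  have hzero : (fun _ => 0 : Fin r → I) ∈ Cube.boundary (Fin r) := ⟨0, Or.inl rfl⟩
  let L := cov.liftHomotopy ⟨fun q : I × (Fin r → I) => f fun i => q.1 * q.2 i,
    f.1.continuous.comp (by fun_prop)⟩ (.const _ a) fun y => by
      simpa using f.2 (fun _ => 0) hzero
  have hL : ∀ q, p (L q) = f fun i => q.1 * q.2 i := congrFun (cov.liftHomotopy_lifts ..)
  let F : C(Fin r → I, E) := L.comp ⟨fun y => (1, y), by fun_prop⟩
  have hF : ∀ y, p (F y) = f y := fun y => (hL _).trans (by simp)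
  have hF0 : F (fun _ => 0) = a := by
    refine (cov.const_of_comp (g := fun t => L (t, fun _ => 0)) (by fun_prop) (fun t t' => ?_)
      1 0).trans (cov.liftHomotopy_zero ..)
    simp only [hL, mul_zero]
  have hpath : ∀ γ : C(I, Fin r → I), (∀ t, γ t ∈ Cube.boundary (Fin r)) →
      F (γ 1) = F (γ 0) := by
    intro γ hγ
    refine cov.const_of_comp (g := fun t => F (γ t)) (by fun_prop) (fun t t' => ?_) 1 0
    rw [hF, hF]
    exact (f.2 _ (hγ t)).trans (f.2 _ (hγ t')).symm
  refine ⟨⟨F, fun y hy => ?_⟩, hF⟩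
  obtain ⟨i, hi⟩ := hy
  have : Nontrivial (Fin r) := Fin.nontrivial_iff_two_le.2 hr
  obtain ⟨j, hji⟩ := exists_ne i
  -- Two moves inside the boundary lead to the origin: push `y j` to `0`, then scale.
  have h1 := hpath ⟨fun t => Function.update y j (t * y j), by fun_prop⟩ fun t =>
    ⟨i, by simpa [hji.symm] using hi⟩
  have h2 := hpath ⟨fun t k => t * Function.update y j 0 k, by fun_prop⟩ fun t =>
    ⟨j, Or.inl (by simp)⟩
  simp only [ContinuousMap.coe_mk, one_mul, zero_mul, Function.update_eq_self] at h1 h2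
  rw [h1, h2, hF0]

theorem subsingleton_homotopyGroup_iff_of_isCoveringMap (cov : IsCoveringMap p) {r : ℕ}
    (hr : 2 ≤ r) (a : E) : Subsingleton (π_ r E a) ↔ Subsingleton (π_ r X (p a)) := by
  let pc : C(E, X) := ⟨p, cov.continuous⟩
  constructor
  · intro h
    refine subsingleton_homotopyGroup_iff.2 fun f => ?_
    obtain ⟨g, hg⟩ := exists_lift_genLoop cov hr f
    have hpg : (pc.comp g.1).HomotopicRel (pc.comp (GenLoop.const (N := Fin r) (x := a)).1)
        (Cube.boundary (Fin r)) :=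
      (subsingleton_homotopyGroup_iff.1 h g).map fun H => H.compContinuousMap pc
    rwa [show pc.comp g.1 = f.1 from ContinuousMap.ext hg] at hpg
  · intro h
    refine subsingleton_homotopyGroup_iff.2 fun f => ?_
    have : NeZero r := ⟨by omega⟩
    have hzero : (fun _ => 0 : Fin r → I) ∈ Cube.boundary (Fin r) := ⟨0, Or.inl rfl⟩
    refine (cov.homotopicRel_iff_comp ⟨_, hzero, f.2 _ hzero⟩).2 ?_
    exact subsingleton_homotopyGroup_iff.1 h ⟨pc.comp f.1, fun y hy => congrArg p (f.2 y hy)⟩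

theorem subsingleton_homotopyGroup_of_isCoveringMap [SimplyConnectedSpace E]
    (cov : IsCoveringMap p) (hX : ∀ r : ℕ, 2 ≤ r → ∀ x : X, Subsingleton (π_ r X x)) (N : ℕ)
    (a : E) : Subsingleton (π_ N E a) := by
  match N with
  | 0 => exact HomotopyGroup.pi0EquivZerothHomotopy.subsingleton
  | 1 => exact HomotopyGroup.pi1EquivFundamentalGroup.subsingleton
  | N + 2 =>
    exact (subsingleton_homotopyGroup_iff_of_isCoveringMap cov (by omega) a).2
      (hX _ (by omega) _)

end Covering

section Sections

theorem secatTilde_eq_one_iff {E Y B : Type*} [TopologicalSpace E] [TopologicalSpace Y]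
    [TopologicalSpace B] {p : E → Y} {q : Y → B} :
    secatTilde p q = 1 ↔ ∃ s : C(Y, E), ∀ y, p (s y) = y := by
  constructor
  · intro h
    have hne : {m : ℕ∞ | ∃ k : ℕ, m = (k : ℕ∞) ∧ 1 ≤ k ∧ ∃ U : Fin k → Set B,
        (∀ i, IsOpen (U i)) ∧ (⋃ i, U i) = Set.univ ∧
          ∀ i, ∃ s : C(q ⁻¹' U i, E), ∀ y : q ⁻¹' U i, p (s y) = y}.Nonempty := by
      by_contra hne
      rw [secatTilde, Set.not_nonempty_iff_eq_empty.1 hne, sInf_empty] at h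
      exact absurd h (by decide)
    obtain ⟨k, hk, -, U, -, hU, hs⟩ := csInf_mem hne
    rw [show sInf _ = (1 : ℕ∞) from h] at hk
    obtain rfl : k = 1 := by exact_mod_cast hk.symm
    obtain ⟨s, hs⟩ := hs 0
    have hmem : ∀ y, y ∈ q ⁻¹' U 0 := fun y => by
      obtain ⟨i, hi⟩ := Set.mem_iUnion.1 (hU ▸ Set.mem_univ (q y))
      rwa [Subsingleton.elim i 0] at hi
    exact ⟨s.comp ⟨fun y => ⟨y, hmem y⟩, by fun_prop⟩, fun y => hs ⟨y, hmem y⟩⟩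
  · rintro ⟨s, hs⟩
    refine le_antisymm (sInf_le ⟨1, rfl, le_rfl, fun _ => Set.univ, fun _ => isOpen_univ,
      Set.iUnion_const _, fun _ => ⟨s.comp ⟨Subtype.val, continuous_subtype_val⟩,
        fun y => hs y⟩⟩) (le_sInf ?_)
    rintro _ ⟨k, rfl, hk, -⟩
    exact_mod_cast hk

theorem gridPoint_zero {n : ℕ} (hn : 0 < n) : gridPoint n ⟨0, hn⟩ = 0 :=
  Subtype.ext (by simp [gridPoint])

theorem gridPoint_last {n : ℕ} (hn : 2 ≤ n) : gridPoint n ⟨n - 1, by omega⟩ = 1 := by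
  refine Subtype.ext ?_
  have h : (n : ℝ) - 1 ≠ 0 := by
    have : (2 : ℝ) ≤ n := by exact_mod_cast hn
    linarith
  simp [gridPoint, Nat.cast_sub (show 1 ≤ n by omega), div_self h]

variable {X : Type*} [TopologicalSpace X] {x₀ : X}

/-- The map `[ω] ↦ P ∘ ω` from paths in the universal cover modulo the fundamental group to paths
in `X`. -/
noncomputable def pathProjection : C(PathQuotient X x₀, C(I, X)) where
  toFun := Quotient.lift
    (fun ω => (⟨UniversalCover.proj, UniversalCover.continuous_proj⟩ : C(_, X)).comp ω) (by
      rintro ω ω' ⟨g, rfl⟩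
      rfl)
  continuous_toFun := Continuous.quotient_lift (by fun_prop) _

theorem exists_rep_of_pathEvaluation_eq {n : ℕ} {w : PathQuotient X x₀}
    {x : Fin n → UniversalCover X x₀} (h : pathEvaluation n X x₀ w = Quotient.mk'' x) :
    ∃ ω : C(I, UniversalCover X x₀), Quotient.mk'' ω = w ∧ ∀ i, ω (gridPoint n i) = x i := by
  obtain ⟨ω, rfl⟩ := Quotient.exists_rep w
  obtain ⟨g, hg⟩ := Quotient.exact h
  refine ⟨g⁻¹ • ω, Quotient.sound ⟨g⁻¹, rfl⟩, fun i => ?_⟩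
  exact (congrArg (g⁻¹ • ·) (congrFun hg i)).symm.trans (inv_smul_smul g (x i))

namespace UniversalCover

theorem contractibleSpace_of_isCoveringMap_of_section
    (cov : IsCoveringMap (proj : UniversalCover X x₀ → X)) {n : ℕ} (hn : 2 ≤ n)
    (s : C(DiagonalQuotient n X x₀, PathQuotient X x₀))
    (hs : ∀ y, pathEvaluation n X x₀ (s y) = y) (a : UniversalCover X x₀) :
    ContractibleSpace (UniversalCover X x₀) := by
  let F : UniversalCover X x₀ → Fin n → UniversalCover X x₀ :=
    Function.update (fun _ => a) ⟨n - 1, by omega⟩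
  let S : C(UniversalCover X x₀, PathQuotient X x₀) :=
    s.comp ⟨fun x => Quotient.mk'' (F x), continuous_quot_mk.comp (by fun_prop)⟩
  choose ω hωS hωF using fun x => exists_rep_of_pathEvaluation_eq (hs (Quotient.mk'' (F x)))
  have hω0 : ∀ x, ω x 0 = a := fun x => by
    rw [← gridPoint_zero (by omega : 0 < n), hωF]
    exact Function.update_of_ne (by simp [Fin.ext_iff]; omega) _ _
  have hω1 : ∀ x, ω x 1 = x := fun x => by
    rw [← gridPoint_last hn, hωF]
    exact Function.update_self ..
  have hproj : ∀ x t, pathProjection (S x) t = (ω x t).proj := fun x t =>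
    congrArg (fun w => pathProjection w t) (hωS x).symm
  let L := cov.liftHomotopy ⟨fun q : I × UniversalCover X x₀ => pathProjection (S q.2) q.1,
    by fun_prop⟩ (.const _ a) fun x => (hproj x 0).trans (congrArg proj (hω0 x))
  have hL : ∀ x t, L (t, x) = ω x t := fun x t =>
    congrFun (cov.eq_of_comp_eq (by fun_prop) (ω x).continuous
      (funext fun t => (congrFun (cov.liftHomotopy_lifts ..) (t, x)).trans (hproj x t)) 0
      ((cov.liftHomotopy_zero ..).trans (hω0 x).symm)) t
  refine contractible_iff_id_nullhomotopic _ |>.2 ⟨a, ContinuousMap.Homotopic.symm ⟨L, ?_, ?_⟩⟩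
  · exact fun x => (hL x 0).trans (hω0 x)
  · exact fun x => (hL x 1).trans (hω1 x)

theorem isAspherical_of_tcTilde_eq_one [PathConnectedSpace X] [LocallyPathConnectedSpace X]
    (hX : IsSemilocallySimplyConnected X) {n : ℕ} (hn : 2 ≤ n) (h : tcTilde n X x₀ = 1) :
    IsAspherical X := by
  have cov := (isQuotientCoveringMap_proj (x₀ := x₀) hX).isCoveringMap
  obtain ⟨s, hs⟩ := secatTilde_eq_one_iff.1 h
  refine ⟨inferInstance, fun r hr x => ?_⟩
  obtain ⟨a, rfl⟩ := surjective_proj (x₀ := x₀) x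
  have := contractibleSpace_of_isCoveringMap_of_section cov hn s hs a
  exact (subsingleton_homotopyGroup_iff_of_isCoveringMap cov hr a).1
    (subsingleton_homotopyGroup_of_contractibleSpace r a)

end UniversalCover

end Sections

theorem finite_setOf_eq_smul {G E X T : Type*} [Group G] [TopologicalSpace E] [MulAction G E]
    [TopologicalSpace X] [TopologicalSpace T] [CompactSpace T] {p : E → X}
    (hp : IsQuotientCoveringMap p G) {f f' : T → E} (hf : Continuous f) (hf' : Continuous f')
    (h : ∀ t, p (f t) = p (f' t)) : {g : G | ∃ t, f t = g • f' t}.Finite := by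
  have := hp.toContinuousConstSMul
  have := hp.isCancelSMul
  choose γ hγ using fun t => hp.apply_eq_iff_mem_orbit.1 (h t)
  replace hγ : ∀ t, f t = γ t • f' t := fun t => (hγ t).symm
  have heq : ∀ g t, γ t = g ↔ f t = g • f' t := fun g t =>
    ⟨fun e => e ▸ hγ t, fun e => IsCancelSMul.right_cancel _ _ _ ((hγ t).symm.trans e)⟩
  have hlocal : IsLocallyConstant γ := IsLocallyConstant.iff_isOpen_fiber.2 fun g => by
    have hfiber : γ ⁻¹' {g} = {t | f t = g • f' t} := Set.ext fun t => heq g t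
    rw [hfiber]
    exact hp.isCoveringMap.isLocalHomeomorph.isLocallyInjective.isOpen_eqLocus hf
      (hf'.const_smul g) (funext fun t => (h t).trans (hp.map_smul ..).symm)
  refine hlocal.range_finite.subset ?_
  rintro g ⟨t, ht⟩
  exact ⟨t, (heq g t).2 ht⟩

open Metric in
theorem mem_closedBall_zero_prod {V W : Type*} [SeminormedAddCommGroup V]
    [SeminormedAddCommGroup W] {z : V × W} {r : ℝ} :
    z ∈ closedBall 0 r ↔ z.1 ∈ closedBall 0 r ∧ z.2 ∈ closedBall 0 r := by
  rw [← Prod.mk_zero_zero, ← closedBall_prod_same]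
  rfl

namespace EquivariantCells

open Metric Set

variable {Γ Y Z A B : Type*} [Group Γ] [MulAction Γ Y] [TopologicalSpace Y] [MulAction Γ Z]
  [TopologicalSpace Z] {V : A → Type*} [∀ a, NormedAddCommGroup (V a)] {W : B → Type*}
  [∀ b, NormedAddCommGroup (W b)] (𝒞 : EquivariantCells Γ Y V) (𝒟 : EquivariantCells Γ Z W)

theorem prod_unique {g g' k k' : Γ} {a a' : A} {b b' : B} {z : V a} {z' : V a'} {w : W b}
    {w' : W b'} (hz : z ∈ ball 0 1) (hz' : z' ∈ ball 0 1) (hw : w ∈ ball 0 1)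
    (hw' : w' ∈ ball 0 1) (e : g • 𝒞.map a z = g' • 𝒞.map a' z')
    (e' : g • k • 𝒟.map b w = g' • k' • 𝒟.map b' w') :
    (⟨g, (a, b, k), (z, w)⟩ : Γ × Σ c : A × B × Γ, V c.1 × W c.2.1) =
      ⟨g', (a', b', k'), (z', w')⟩ := by
  cases 𝒞.unique hz hz' e
  simp only [← mul_smul] at e'
  obtain ⟨hk, hbw⟩ := Prod.mk.inj (𝒟.unique hw hw' e')
  cases hbw
  obtain rfl := mul_left_cancel hk
  rfl

theorem prod_boundary (a : A) (b : B) (k : Γ) :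
    ∃ F : Set (Γ × A × B × Γ), F.Finite ∧
      (∀ c ∈ F, 𝒞.dim c.2.1 + 𝒟.dim c.2.2.1 < 𝒞.dim a + 𝒟.dim b) ∧
      ∀ z ∈ sphere (0 : V a × W b) 1, ∃ c ∈ F,
        ∃ w ∈ closedBall (0 : V c.2.1 × W c.2.2.1) 1,
          (𝒞.map a z.1, k • 𝒟.map b z.2) =
            c.1 • (𝒞.map c.2.1 w.1, c.2.2.2 • 𝒟.map c.2.2.1 w.2) := by
  obtain ⟨F, hF, hFd, hFa⟩ := 𝒞.boundary a
  obtain ⟨F', hF', hFd', hFb⟩ := 𝒟.boundary b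
  refine ⟨(fun c : Γ × A => (c.1, c.2, b, c.1⁻¹ * k)) '' F ∪
    (fun c : Γ × B => (1, a, c.2, k * c.1)) '' F', (hF.image _).union (hF'.image _), ?_, ?_⟩
  · rintro _ (⟨c, hc, rfl⟩ | ⟨c, hc, rfl⟩)
    · exact Nat.add_lt_add_right (hFd c hc) _
    · exact Nat.add_lt_add_left (hFd' c hc) _
  · rintro ⟨z, w⟩ hzw
    rcases mem_sphere_zero_prod.1 hzw with ⟨hz, hw⟩ | ⟨hz, hw⟩
    · obtain ⟨c, hc, x, hx, e⟩ := hFa z hz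
      exact ⟨_, .inl ⟨c, hc, rfl⟩, (x, w), mem_closedBall_zero_prod.2 ⟨hx, hw⟩,
        by simp [e, mul_smul]⟩
    · obtain ⟨c, hc, x, hx, e⟩ := hFb w hw
      exact ⟨_, .inr ⟨c, hc, rfl⟩, (z, x), mem_closedBall_zero_prod.2 ⟨hz, hx⟩,
        by simp [e, mul_smul]⟩

/-- The product cell structure, for the diagonal action. Its orbits of cells are indexed by triples
`(a, b, k)`, which stand for the orbit of the product of the cell `a` with the translate of the
cell `b` by `k`. -/
noncomputable def prod [ContinuousConstSMul Γ Z] :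
    EquivariantCells Γ (Y × Z) (fun a : A × B × Γ => V a.1 × W a.2.1) where
  dim a := 𝒞.dim a.1 + 𝒟.dim a.2.1
  map a z := (𝒞.map a.1 z.1, a.2.2 • 𝒟.map a.2.1 z.2)
  continuousOn a :=
    have hmem {z} (hz : z ∈ closedBall (0 : V a.1 × W a.2.1) 1) := mem_closedBall_zero_prod.1 hz
    ((𝒞.continuousOn a.1).comp continuousOn_fst fun _ hz => (hmem hz).1).prodMk
      (((𝒟.continuousOn a.2.1).comp continuousOn_snd fun _ hz => (hmem hz).2).const_smul a.2.2)
  exists_eq := by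
    rintro ⟨x, y⟩
    obtain ⟨g, a, z, hz, rfl⟩ := 𝒞.exists_eq x
    obtain ⟨h, b, w, hw, rfl⟩ := 𝒟.exists_eq y
    exact ⟨g, (a, b, g⁻¹ * h), (z, w), mem_closedBall_zero_prod.2 ⟨hz, hw⟩, by simp [mul_smul]⟩
  unique := by
    rintro g g' ⟨a, b, k⟩ ⟨a', b', k'⟩ ⟨z, w⟩ ⟨z', w'⟩ h h' e
    rw [← Prod.mk_zero_zero, ← ball_prod_same] at h h'
    exact 𝒞.prod_unique 𝒟 h.1 h'.1 h.2 h'.2 (congrArg Prod.fst e) (congrArg Prod.snd e)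
  boundary := fun ⟨a, b, k⟩ => 𝒞.prod_boundary 𝒟 a b k

/-- A set is finitely covered if it is contained in the union of finitely many closed cells. -/
def IsFinitelyCovered (K : Set Y) : Prop :=
  ∃ F : Set (Γ × A), F.Finite ∧ K ⊆ ⋃ b ∈ F, (fun z => b.1 • 𝒞.map b.2 z) '' closedBall 0 1

variable {𝒞 𝒟}

theorem IsFinitelyCovered.prod [ContinuousConstSMul Γ Z] {K : Set Y} {L : Set Z}
    (hK : 𝒞.IsFinitelyCovered K) (hL : 𝒟.IsFinitelyCovered L) :
    (𝒞.prod 𝒟).IsFinitelyCovered (K ×ˢ L) := by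
  obtain ⟨F, hF, hKF⟩ := hK
  obtain ⟨F', hF', hLF'⟩ := hL
  let j : (Γ × A) × (Γ × B) → Γ × A × B × Γ := fun q =>
    (q.1.1, q.1.2, q.2.2, q.1.1⁻¹ * q.2.1)
  refine ⟨j '' (F ×ˢ F'), (hF.prod hF').image j, ?_⟩
  rintro ⟨x, y⟩ ⟨hx, hy⟩
  obtain ⟨b, hb, z, hz, rfl⟩ := mem_iUnion₂.1 (hKF hx)
  obtain ⟨b', hb', w, hw, rfl⟩ := mem_iUnion₂.1 (hLF' hy)
  exact mem_biUnion (mem_image_of_mem j (mk_mem_prod hb hb'))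
    ⟨(z, w), mem_closedBall_zero_prod.2 ⟨hz, hw⟩, by simp [j, EquivariantCells.prod, mul_smul]⟩

end EquivariantCells

open Metric Set in
/-- A choice of lifts of the characteristic maps of a CW complex to a space over it. -/
structure CharMapLift {E X : Type*} [TopologicalSpace E] [TopologicalSpace X]
    [CWComplex (univ : Set X)] (p : E → X) where
  map : ∀ a : CWCell X, (Fin a.1 → ℝ) → E
  continuousOn : ∀ a, ContinuousOn (map a) (closedBall 0 1)
  proj_map : ∀ a : CWCell X, ∀ z ∈ closedBall (0 : Fin a.1 → ℝ) 1, p (map a z) = CWCell.charMap a z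

namespace CharMapLift

open Metric Set CWCell

variable {G E X : Type*} [Group G] [TopologicalSpace E] [TopologicalSpace X] [MulAction G E]
  [CWComplex (univ : Set X)] {p : E → X}

theorem nonempty_of_isCoveringMap (cov : IsCoveringMap p) (hp : p.Surjective) :
    Nonempty (CharMapLift p) := by
  have h (a : CWCell X) : ∃ F : (Fin a.1 → ℝ) → E, ContinuousOn F (closedBall 0 1) ∧
      ∀ z ∈ closedBall (0 : Fin a.1 → ℝ) 1, p (F z) = charMap a z := by
    obtain ⟨e, he⟩ := hp (charMap a 0)
    obtain ⟨F, hF, hpF, -⟩ := exists_lift_closedBall cov (continuousOn_charMap a) he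
    exact ⟨F, hF, hpF⟩
  choose Φ hΦ hpΦ using h
  exact ⟨⟨Φ, hΦ, hpΦ⟩⟩

variable (hp : IsQuotientCoveringMap p G) (Φ : CharMapLift p)

include hp

theorem eq_of_smul_map_eq {g g' : G} {a a' : CWCell X} {z : Fin a.1 → ℝ} {z' : Fin a'.1 → ℝ}
    (hz : z ∈ ball 0 1) (hz' : z' ∈ ball 0 1) (e : g • Φ.map a z = g' • Φ.map a' z') :
    (⟨g, a, z⟩ : G × Σ a : CWCell X, Fin a.1 → ℝ) = ⟨g', a', z'⟩ := by
  have := hp.isCancelSMul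
  have hchar : charMap a z = charMap a' z' := by
    rw [← Φ.proj_map a z (ball_subset_closedBall hz),
      ← Φ.proj_map a' z' (ball_subset_closedBall hz'), ← hp.map_smul g, e, hp.map_smul]
  cases charMap_injective hz hz' hchar
  obtain rfl : g = g' := IsCancelSMul.right_cancel _ _ _ e
  rfl

variable [T2Space X]

theorem finite_setOf_translates {K : Set E} (hK : IsCompact K) (c : CWCell X) :
    {g : G | ∃ x ∈ K, ∃ z ∈ closedBall (0 : Fin c.1 → ℝ) 1, x = g • Φ.map c z}.Finite := by
  have : CompactSpace K := isCompact_iff_compactSpace.1 hK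
  have : CompactSpace (closedBall (0 : Fin c.1 → ℝ) 1) :=
    isCompact_iff_compactSpace.1 (isCompact_closedBall _ _)
  have hchar : Continuous fun z : closedBall (0 : Fin c.1 → ℝ) 1 => charMap c z :=
    continuousOn_iff_continuous_domRestrict.1 (continuousOn_charMap c)
  have hΦ : Continuous fun z : closedBall (0 : Fin c.1 → ℝ) 1 => Φ.map c z :=
    continuousOn_iff_continuous_domRestrict.1 (Φ.continuousOn c)
  have hpc := hp.continuous
  let T := {q : K × closedBall (0 : Fin c.1 → ℝ) 1 | p q.1 = charMap c q.2}
  have : CompactSpace T := isCompact_iff_compactSpace.1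
    (isClosed_eq (by fun_prop) (hchar.comp continuous_snd)).isCompact
  refine (finite_setOf_eq_smul hp (f := fun t : T => (t.1.1 : E)) (f' := fun t => Φ.map c t.1.2)
    (by fun_prop) (hΦ.comp (by fun_prop))
    fun t => t.2.trans (Φ.proj_map c _ t.1.2.2).symm).subset ?_
  rintro g ⟨x, hx, z, hz, rfl⟩
  exact ⟨⟨(⟨_, hx⟩, ⟨z, hz⟩), (hp.map_smul ..).trans (Φ.proj_map c z hz)⟩, rfl⟩

theorem exists_finite_iUnion {K : Set E} (hK : IsCompact K) {F : Set (CWCell X)} (hF : F.Finite)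
    (hKF : ∀ x ∈ K, ∃ c ∈ F, p x ∈ charMap c '' closedBall 0 1) :
    ∃ F' : Set (G × CWCell X), F'.Finite ∧ (∀ b ∈ F', b.2 ∈ F) ∧
      K ⊆ ⋃ b ∈ F', (fun z => b.1 • Φ.map b.2 z) '' closedBall 0 1 := by
  let D (c : CWCell X) : Set G :=
    {g | ∃ x ∈ K, ∃ z ∈ closedBall (0 : Fin c.1 → ℝ) 1, x = g • Φ.map c z}
  refine ⟨⋃ c ∈ F, (·, c) '' D c,
    hF.biUnion fun c _ => (Φ.finite_setOf_translates hp hK c).image _, fun b hb => ?_,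
    fun x hx => ?_⟩
  · obtain ⟨c, hc, g, -, rfl⟩ := mem_iUnion₂.1 hb
    exact hc
  · obtain ⟨c, hc, z, hz, e⟩ := hKF x hx
    obtain ⟨g, rfl⟩ := hp.apply_eq_iff_mem_orbit.1 (e.symm.trans (Φ.proj_map c z hz).symm)
    exact mem_biUnion (mem_biUnion hc ⟨g, ⟨_, hx, z, hz, rfl⟩, rfl⟩) ⟨z, hz, rfl⟩

/-- The cell structure of a covering space of a CW complex, given by lifts of the characteristic
maps and their translates by deck transformations. -/
noncomputable def equivariantCells :
    EquivariantCells G E (fun a : CWCell X => Fin a.1 → ℝ) where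
  dim a := a.1
  map := Φ.map
  continuousOn := Φ.continuousOn
  exists_eq x := by
    obtain ⟨a, z, hz, e⟩ := exists_eq_charMap (p x)
    obtain ⟨g, rfl⟩ := hp.apply_eq_iff_mem_orbit.1 (e.trans (Φ.proj_map a z hz).symm)
    exact ⟨g, a, z, hz, rfl⟩
  unique := Φ.eq_of_smul_map_eq hp
  boundary a := by
    obtain ⟨F, hF, hFd, hFa⟩ := exists_finite_boundary a
    obtain ⟨F', hF', hF'F, h⟩ := Φ.exists_finite_iUnion hp
      ((isCompact_sphere (0 : Fin a.1 → ℝ) 1).image_of_continuousOn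
        ((Φ.continuousOn a).mono sphere_subset_closedBall)) hF (by
          rintro _ ⟨z, hz, rfl⟩
          obtain ⟨d, hd, w, hw, e⟩ := hFa z hz
          exact ⟨d, hd, w, hw, by rw [Φ.proj_map a z (sphere_subset_closedBall hz), e]⟩)
    refine ⟨F', hF', fun b hb => hFd _ (hF'F b hb), fun z hz => ?_⟩
    obtain ⟨b, hb, w, hw, e⟩ := mem_iUnion₂.1 (h ⟨z, hz, rfl⟩)
    exact ⟨b, hb, w, hw, e.symm⟩

theorem isFinitelyCovered_of_isCompact {K : Set E} (hK : IsCompact K) :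
    (Φ.equivariantCells hp).IsFinitelyCovered K := by
  obtain ⟨F, hF, -, hKF⟩ := Φ.exists_finite_iUnion hp hK
    (finite_openCell_inter_nonempty (hK.image hp.continuous)) fun x hx => by
      obtain ⟨a, z, hz, e⟩ := exists_mem_ball_eq_charMap (p x)
      exact ⟨a, ⟨_, ⟨z, hz, e.symm⟩, x, hx, rfl⟩, z, ball_subset_closedBall hz, e.symm⟩
  exact ⟨F, hF, hKF⟩

end CharMapLift

section PathExtension

open Metric Set

theorem exists_continuousOn_curry {T Z E : Type*} [TopologicalSpace T] [TopologicalSpace Z]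
    [TopologicalSpace E] [Nonempty E] {B : Set Z} {f : T × Z → E}
    (hf : ContinuousOn f (univ ×ˢ B)) :
    ∃ ψ : Z → C(T, E), ContinuousOn ψ B ∧ ∀ z ∈ B, ∀ t, ψ z t = f (t, z) := by
  classical
  let F : C(B × T, E) := ⟨fun q => f (q.2, q.1), hf.comp_continuous (by fun_prop)
    fun q => ⟨mem_univ _, q.1.2⟩⟩
  let ψ : Z → C(T, E) := fun z => if h : z ∈ B then F.curry ⟨z, h⟩ else
    ContinuousMap.const T (Classical.arbitrary E)
  have hψ : ∀ z (h : z ∈ B), ψ z = F.curry ⟨z, h⟩ := fun z h => dif_pos h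
  refine ⟨ψ, ?_, fun z hz t => ?_⟩
  · rw [continuousOn_iff_continuous_domRestrict]
    exact F.curry.continuous.congr fun z => (hψ z z.2).symm
  · rw [hψ z hz]
    rfl

variable {E V : Type*} [TopologicalSpace E] [NormedAddCommGroup V] {m : V → E × E}
  {φ : V → C(I, E)}

theorem exists_prism_boundary_map (hm : ContinuousOn m (closedBall 0 1))
    (hφ : ContinuousOn φ (sphere 0 1)) (h : ∀ z ∈ sphere (0 : V) 1, (φ z 0, φ z 1) = m z) :
    ∃ f : ℝ × V → E, ContinuousOn f (sphere 0 1) ∧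
      (∀ z ∈ closedBall (0 : V) 1, (f (-1, z), f (1, z)) = m z) ∧
      ∀ (t : I), ∀ z ∈ sphere (0 : V) 1, f (2 * (t : ℝ) - 1, z) = φ z t := by
  classical
  let c : ℝ → I := fun t => projIcc 0 1 zero_le_one ((t + 1) / 2)
  have hc : ∀ t : I, c (2 * (t : ℝ) - 1) = t := fun t => by
    simp only [c, sub_add_cancel, mul_div_cancel_left₀ _ (two_ne_zero' ℝ), projIcc_val]
  have hc0 : c (-1) = 0 := by simpa using hc 0
  have hc1 : c 1 = 1 := by simpa [show (2 : ℝ) - 1 = 1 by norm_num] using hc 1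
  let ends : ℝ × V → E := fun w => if w.1 ≤ 0 then (m w.2).1 else (m w.2).2
  let f : ℝ × V → E := fun w => if w.2 ∈ sphere 0 1 then φ w.2 (c w.1) else ends w
  have hends : EqOn f ends (sphere 0 1 ×ˢ closedBall 0 1) := by
    rintro ⟨t, z⟩ ⟨ht, -⟩
    refine ite_eq_right_iff.2 fun hz => ?_
    have hmz := h z hz
    rcases eq_or_eq_neg_of_abs_eq (mem_sphere_zero_iff_norm.1 ht) with rfl | rfl
    · simp [ends, ← hmz, hc1, show ¬ (1 : ℝ) ≤ 0 by norm_num]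
    · simp [ends, ← hmz, hc0]
  have hends_cont : ContinuousOn ends (sphere 0 1 ×ˢ closedBall 0 1) := by
    have hm' : ContinuousOn (fun w : ℝ × V => m w.2) (sphere 0 1 ×ˢ closedBall 0 1) :=
      hm.comp continuousOn_snd fun w hw => hw.2
    refine ContinuousOn.if (fun w hw => ?_) (hm'.fst.mono inter_subset_left)
      (hm'.snd.mono inter_subset_left)
    have h0 : w.1 = 0 := frontier_le_subset_eq continuous_fst continuous_const hw.2
    exact absurd (mem_sphere_zero_iff_norm.1 hw.1.1) (by norm_num [h0])
  have hside : ContinuousOn f (closedBall 0 1 ×ˢ sphere 0 1) := by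
    have hφ' : ContinuousOn (fun w : ℝ × V => φ w.2) (closedBall 0 1 ×ˢ sphere 0 1) :=
      hφ.comp continuousOn_snd fun w hw => hw.2
    exact (hφ'.eval (by fun_prop)).congr fun w hw => if_pos hw.2
  refine ⟨f, ?_, fun z hz => ?_, fun t z hz => (if_pos hz).trans (congrArg (φ z) (hc t))⟩
  · rw [sphere_prod]
    exact (hends_cont.congr hends).union_of_isClosed hside
      (isClosed_sphere.prod isClosed_closedBall) (isClosed_closedBall.prod isClosed_sphere)
  · rw [hends ⟨by simp, hz⟩, hends ⟨by simp, hz⟩]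
    simp [ends, show ¬ (1 : ℝ) ≤ 0 by norm_num]

theorem exists_path_extension [NormedSpace ℝ V] [Nonempty E] {N : ℕ} {e : V ≃ᵢ (Fin N → ℝ)}
    (he : e 0 = 0) (hE : ∀ y : E, Subsingleton (HomotopyGroup.Pi N E y))
    (hm : ContinuousOn m (closedBall 0 1)) (hφ : ContinuousOn φ (sphere 0 1))
    (h : ∀ z ∈ sphere (0 : V) 1, (φ z 0, φ z 1) = m z) :
    ∃ ψ : V → C(I, E), ContinuousOn ψ (closedBall 0 1) ∧
      (∀ z ∈ closedBall (0 : V) 1, (ψ z 0, ψ z 1) = m z) ∧ EqOn ψ φ (sphere 0 1) := by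
  obtain ⟨f, hf, hfm, hfφ⟩ := exists_prism_boundary_map hm hφ h
  obtain ⟨F, hF, hFf⟩ := exists_extend_closedBall_of_subsingleton_homotopyGroup he hE hf
  obtain ⟨ψ, hψ, hψF⟩ := exists_continuousOn_curry (T := I) (B := closedBall (0 : V) 1)
    (f := fun q => F (2 * (q.1 : ℝ) - 1, q.2)) (by fun_prop)
  refine ⟨ψ, hψ, fun z hz => ?_, fun z hz => ContinuousMap.ext fun t => ?_⟩
  · have h0 : (2 * ((0 : I) : ℝ) - 1) = -1 := by norm_num
    have h1 : (2 * ((1 : I) : ℝ) - 1) = 1 := by norm_num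
    have hs : ∀ t : ℝ, t ∈ sphere 0 1 → (t, z) ∈ sphere (0 : ℝ × V) 1 := fun t ht =>
      mem_sphere_zero_prod.2 (.inl ⟨ht, hz⟩)
    rw [hψF z hz, hψF z hz, h0, h1, hFf _ (hs _ (by simp)), hFf _ (hs _ (by simp)), hfm z hz]
  · rw [hψF z (sphere_subset_closedBall hz), hFf _ (mem_sphere_zero_prod.2
      (.inr ⟨two_mul_sub_one_mem_closedBall t, hz⟩)), hfφ t z hz]

end PathExtension

section EquivariantPaths

open Metric Set

variable {G E X : Type*} [Group G] [TopologicalSpace E] [TopologicalSpace X] [MulAction G E]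
  [CWComplex (univ : Set X)] [T2Space X] [T2Space E] [Nonempty E]
  [ContinuousConstSMul G E] {p : E → X}

theorem exists_equivariant_paths (hp : IsQuotientCoveringMap p G)
    (hE : ∀ (N : ℕ) (y : E), Subsingleton (HomotopyGroup.Pi N E y)) :
    ∃ τ : E × E → C(I, E), (∀ y, (τ y 0, τ y 1) = y) ∧ (∀ (g : G) y, τ (g • y) = g • τ y) ∧
      ∀ K L : Set E, IsCompact K → IsCompact L → ContinuousOn τ (K ×ˢ L) := by
  have : Nonempty C(I, E) := ⟨ContinuousMap.const I (Classical.arbitrary E)⟩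
  obtain ⟨Φ⟩ := CharMapLift.nonempty_of_isCoveringMap hp.isCoveringMap hp.surjective
  let 𝒞 := Φ.equivariantCells hp
  obtain ⟨τ, hτ, hτG, hτcell⟩ := (𝒞.prod 𝒞).exists_equivariant_section (E := C(I, E))
    (p := fun ω => (ω 0, ω 1)) (fun g ω => rfl) (fun _ _ => True) (fun a φ hφ h => by
      obtain ⟨ψ, hψ, hψm, hψφ⟩ := exists_path_extension
        (e := Fin.appendIsometry a.1.1 a.2.1.1)
        (by ext i; refine Fin.addCases (fun i => ?_) (fun i => ?_) i <;> simp)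
        (hE _) ((𝒞.prod 𝒞).continuousOn a) hφ h
      exact ⟨ψ, hψ, hψm, hψφ, trivial⟩)
  refine ⟨τ, hτ, hτG, fun K L hK hL => ?_⟩
  obtain ⟨F, hF, hKL⟩ := (Φ.isFinitelyCovered_of_isCompact hp hK).prod
    (Φ.isFinitelyCovered_of_isCompact hp hL)
  exact ((𝒞.prod 𝒞).continuousOn_iUnion_of_finite hτG hF fun b _ => (hτcell b.2).1).mono hKL

end EquivariantPaths

theorem eventuallyEq_of_isCoveringMap {A E X : Type*} [TopologicalSpace A] [TopologicalSpace E]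
    [TopologicalSpace X] {p : E → X} (cov : IsCoveringMap p) {f f' : A → E} {U : Set A}
    (hU : IsOpen U) (hf : ContinuousOn f U) (hf' : ContinuousOn f' U)
    (h : ∀ y ∈ U, p (f y) = p (f' y)) {x : A} (hx : x ∈ U) (hfx : f x = f' x) :
    f =ᶠ[𝓝 x] f' := by
  have hopen : IsOpen {y : U | f y = f' y} :=
    cov.isLocalHomeomorph.isLocallyInjective.isOpen_eqLocus
      (continuousOn_iff_continuous_domRestrict.1 hf)
      (continuousOn_iff_continuous_domRestrict.1 hf') (funext fun y => h y y.2)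
  filter_upwards [(hU.isOpenMap_subtype_val _ hopen).mem_nhds ⟨⟨x, hx⟩, hfx, rfl⟩]
  rintro _ ⟨y, hy, rfl⟩
  exact hy

theorem exists_equivariant_lift_homotopy {G E X : Type*} [Group G] [TopologicalSpace E]
    [TopologicalSpace X] [MulAction G E] {p : E → X} (hp : IsQuotientCoveringMap p G)
    {k : C(X, X)} (H : (ContinuousMap.id X).Homotopy k) :
    ∃ L : C(I × E, E), (∀ x, L (0, x) = x) ∧ (∀ x, p (L (1, x)) = k (p x)) ∧
      ∀ (g : G) t x, L (t, g • x) = g • L (t, x) := by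
  have cov := hp.isCoveringMap
  have := hp.toContinuousConstSMul
  let f : C(I × E, X) := ⟨fun q => H (q.1, p q.2), by have := hp.continuous; fun_prop⟩
  have hf0 : ∀ x, f (0, x) = p (ContinuousMap.id E x) := fun x => H.apply_zero (p x)
  let L := cov.liftHomotopy f (ContinuousMap.id E) hf0
  have hL : ∀ q, p (L q) = H (q.1, p q.2) := congrFun (cov.liftHomotopy_lifts f _ hf0)
  have hL0 : ∀ x, L (0, x) = x := cov.liftHomotopy_zero f _ hf0
  refine ⟨L, hL0, fun x => (hL _).trans (H.apply_one _), fun g t x => ?_⟩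
  refine congrFun (cov.eq_of_comp_eq (g₁ := fun t => L (t, g • x)) (g₂ := fun t => g • L (t, x))
    (by fun_prop) (by fun_prop) (funext fun t => ?_) 0 ?_) t
  · simp only [Function.comp_apply, hp.map_smul, hL]
  · simp only [hL0]

namespace CWCell

open Metric Set

variable {G E X : Type*} [Group G] [TopologicalSpace E] [TopologicalSpace X] [MulAction G E]
  [CWComplex (univ : Set X)] {p : E → X}

theorem IsCollarCollapsing.exists_isCompact_eventually_mem [T2Space X] {k : X → X}
    (hk : IsCollarCollapsing k) (hp : IsQuotientCoveringMap p G) {l : E → E} (hl : Continuous l)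
    (hlk : ∀ x, p (l x) = k (p x)) (x : E) :
    ∃ K : Set E, IsCompact K ∧ ∀ᶠ y in 𝓝 x, l y ∈ K := by
  have := hp.toContinuousConstSMul
  obtain ⟨Φ⟩ := CharMapLift.nonempty_of_isCoveringMap hp.isCoveringMap hp.surjective
  obtain ⟨a, V, r, hV, hxV, hr, hrV, hkr⟩ := hk.exists_eq_comp_charMap (p x)
  have hlΦ : ContinuousOn (fun z => l (Φ.map a z)) (closedBall 0 1) :=
    hl.comp_continuousOn (Φ.continuousOn a)
  have hrB : MapsTo (fun y => r (p y)) (p ⁻¹' V) (closedBall 0 1) := fun y hy =>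
    ball_subset_closedBall (hrV hy)
  have hpl : ∀ y ∈ p ⁻¹' V, p (l y) = p (l (Φ.map a (r (p y)))) := fun y hy => by
    rw [hlk, hlk, Φ.proj_map a _ (hrB hy), ← hkr _ hy]
  obtain ⟨g, hg⟩ := hp.apply_eq_iff_mem_orbit.1 (hpl x hxV)
  have hVo : IsOpen (p ⁻¹' V) := hV.preimage hp.continuous
  have hlocal : l =ᶠ[𝓝 x] fun y => g • l (Φ.map a (r (p y))) :=
    eventuallyEq_of_isCoveringMap hp.isCoveringMap hVo hl.continuousOn
      ((hlΦ.comp (hr.comp hp.continuous.continuousOn (mapsTo_preimage p V)) hrB).const_smul g)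
      (fun y hy => (hpl y hy).trans (hp.map_smul g).symm) hxV hg.symm
  refine ⟨(fun z => g • l (Φ.map a z)) '' closedBall 0 1,
    (isCompact_closedBall _ _).image_of_continuousOn (hlΦ.const_smul g), ?_⟩
  filter_upwards [hlocal, hVo.mem_nhds hxV] with y hy hyV
  exact hy ▸ mem_image_of_mem _ (hrB hyV)

end CWCell

theorem continuous_comp_prodMap_of_continuousOn_compact {E F Z : Type*} [TopologicalSpace E]
    [TopologicalSpace F] [TopologicalSpace Z] {τ : E × F → Z}
    (hτ : ∀ (K : Set E) (L : Set F), IsCompact K → IsCompact L → ContinuousOn τ (K ×ˢ L))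
    {l : E → E} {m : F → F} (hl : Continuous l) (hm : Continuous m)
    (hlK : ∀ x, ∃ K, IsCompact K ∧ ∀ᶠ y in 𝓝 x, l y ∈ K)
    (hmL : ∀ x, ∃ L, IsCompact L ∧ ∀ᶠ y in 𝓝 x, m y ∈ L) :
    Continuous (τ ∘ Prod.map l m) := by
  refine continuous_iff_continuousAt.2 fun ⟨x, y⟩ => ?_
  obtain ⟨K, hK, hxK⟩ := hlK x
  obtain ⟨L, hL, hyL⟩ := hmL y
  have hmem : ∀ᶠ q in 𝓝 (x, y), Prod.map l m q ∈ K ×ˢ L := by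
    rw [nhds_prod_eq]
    exact hxK.prod_mk hyL
  exact (hτ K L hK hL _ hmem.self_of_nhds).tendsto.comp
    (tendsto_nhdsWithin_iff.2 ⟨(hl.prodMap hm).continuousAt, hmem⟩)

/-- A choice of a path between any two points of `E` which is continuous in the two points and
equivariant under `G`: an equivariant motion planner on `E`. -/
structure EquivariantPathChoice (G E : Type*) [TopologicalSpace E] [SMul G E] where
  path : ∀ x y : E, Path x y
  continuous_path : Continuous fun q : (E × E) × I => path q.1.1 q.1.2 q.2
  path_smul : ∀ (g : G) x y t, path (g • x) (g • y) t = g • path x y t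

namespace EquivariantPathChoice

variable {G E : Type*} [Group G] [TopologicalSpace E] [MulAction G E]

theorem nonempty_of_deformation {L : C(I × E, E)} (hL0 : ∀ x, L (0, x) = x)
    (hLG : ∀ (g : G) t x, L (t, g • x) = g • L (t, x)) {θ : E × E → C(I, E)} (hθ : Continuous θ)
    (hθ0 : ∀ q, θ q 0 = L (1, q.1)) (hθ1 : ∀ q, θ q 1 = L (1, q.2))
    (hθG : ∀ (g : G) q t, θ (g • q) t = g • θ q t) : Nonempty (EquivariantPathChoice G E) := by
  let γ : ∀ x, Path x (L (1, x)) := fun x => ⟨⟨fun t => L (t, x), by fun_prop⟩, hL0 x, rfl⟩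
  let δ : ∀ q : E × E, Path (L (1, q.1)) (L (1, q.2)) := fun q => ⟨θ q, hθ0 q, hθ1 q⟩
  have hγG : ∀ (g : G) x t, γ (g • x) t = g • γ x t := fun g x t => hLG g t x
  refine ⟨fun x y => ((γ x).trans (δ (x, y))).trans (γ y).symm, ?_, fun g x y t => ?_⟩
  · refine Path.trans_continuous_family (fun q : E × E => (γ q.1).trans (δ q))
      (Path.trans_continuous_family (fun q : E × E => γ q.1) ?_ δ ?_)
      (fun q : E × E => (γ q.2).symm)
      (Path.symm_continuous_family (fun q : E × E => γ q.2) ?_)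
    · exact (by fun_prop : Continuous fun q : (E × E) × I => L (q.2, q.1.1))
    · exact (by fun_prop : Continuous fun q : (E × E) × I => θ q.1 q.2)
    · exact (by fun_prop : Continuous fun q : (E × E) × I => L (q.2, q.1.2))
  · simp only [Path.trans_apply, Path.symm_apply]
    split_ifs
    exacts [hγG .., hθG g (x, y) _, hγG ..]

theorem nonempty_of_isQuotientCoveringMap {X : Type*} [TopologicalSpace X] [T2Space X]
    [CWComplex (Set.univ : Set X)] [T2Space E] [Nonempty E] {p : E → X}
    (hp : IsQuotientCoveringMap p G)
    (hE : ∀ (N : ℕ) (y : E), Subsingleton (HomotopyGroup.Pi N E y)) :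
    Nonempty (EquivariantPathChoice G E) := by
  have := hp.toContinuousConstSMul
  obtain ⟨τ, hτ, hτG, hτK⟩ := exists_equivariant_paths hp hE
  obtain ⟨k, ⟨H⟩, hk⟩ := CWCell.exists_homotopic_id_isCollarCollapsing X
  obtain ⟨L, hL0, hLk, hLG⟩ := exists_equivariant_lift_homotopy hp H
  let l : E → E := fun x => L (1, x)
  have hl : Continuous l := by fun_prop
  have hlK := hk.exists_isCompact_eventually_mem hp hl hLk
  refine nonempty_of_deformation hL0 hLG
    (continuous_comp_prodMap_of_continuousOn_compact hτK hl hl hlK hlK)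
    (fun q => congrArg Prod.fst (hτ (Prod.map l l q)))
    (fun q => congrArg Prod.snd (hτ (Prod.map l l q))) fun g q t => ?_
  have hlG : Prod.map l l (g • q) = g • Prod.map l l q := Prod.ext (hLG ..) (hLG ..)
  rw [Function.comp_apply, hlG, hτG]
  rfl

/-- The concatenation of the chosen paths from `x 0` to `x 1` to `⋯` to `x m`, at unit speed: it
is at `x k` at time `k`. -/
noncomputable def concat (γ : EquivariantPathChoice G E) (x : ℕ → E) : ℕ → ℝ → E
  | 0, _ => x 0
  | m + 1, t => if t ≤ m then γ.concat x m t else (γ.path (x m) (x (m + 1))).extend (t - m)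

variable (γ : EquivariantPathChoice G E)

theorem concat_natCast (x : ℕ → E) {k m : ℕ} (hkm : k ≤ m) : γ.concat x m k = x k := by
  induction m with
  | zero => rw [Nat.le_zero.1 hkm, concat]
  | succ m ih =>
    rw [concat]
    split_ifs with h
    · exact ih (by exact_mod_cast h)
    · obtain rfl : k = m + 1 := by
        have : ¬ k ≤ m := by exact_mod_cast h
        omega
      simp

theorem continuous_concat (m : ℕ) : Continuous fun q : (ℕ → E) × ℝ => γ.concat q.1 m q.2 := by
  induction m with
  | zero =>
    simp only [concat]
    fun_prop
  | succ m ih =>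
    have hpath : Continuous fun q : (ℕ → E) × ℝ =>
        (γ.path (q.1 m) (q.1 (m + 1))).extend (q.2 - m) :=
      (Path.continuous_uncurry_extend_of_continuous_family (fun q : E × E => γ.path q.1 q.2)
        γ.continuous_path).comp
        (by fun_prop : Continuous fun q : (ℕ → E) × ℝ => ((q.1 m, q.1 (m + 1)), q.2 - (m : ℝ)))
    simp only [concat]
    refine ih.if_le hpath continuous_snd continuous_const fun q hq => ?_
    rw [hq, sub_self, Path.extend_zero, γ.concat_natCast _ le_rfl]

theorem concat_smul (g : G) (x : ℕ → E) (m : ℕ) (t : ℝ) :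
    γ.concat (g • x) m t = g • γ.concat x m t := by
  induction m with
  | zero => rfl
  | succ m ih =>
    simp only [concat]
    split_ifs
    exacts [ih, γ.path_smul ..]

end EquivariantPathChoice

theorem exists_section_pathEvaluation {X : Type*} [TopologicalSpace X] {x₀ : X}
    (γ : EquivariantPathChoice (FundamentalGroup X x₀) (UniversalCover X x₀)) {n : ℕ}
    (hn : 2 ≤ n) :
    ∃ s : C(DiagonalQuotient n X x₀, PathQuotient X x₀), ∀ y, pathEvaluation n X x₀ (s y) = y := by
  let ι : (Fin n → UniversalCover X x₀) → ℕ → UniversalCover X x₀ := fun x k =>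
    x ⟨min k (n - 1), by omega⟩
  let S : C(Fin n → UniversalCover X x₀, C(I, UniversalCover X x₀)) := ContinuousMap.curry
    ⟨fun q => γ.concat (ι q.1) (n - 1) (q.2 * ((n : ℝ) - 1)), (γ.continuous_concat (n - 1)).comp
      (by fun_prop : Continuous fun q : (Fin n → UniversalCover X x₀) × I =>
        (ι q.1, (q.2 : ℝ) * ((n : ℝ) - 1)))⟩
  have hSG : ∀ (g : FundamentalGroup X x₀) x, S (g • x) = g • S x := fun g x =>
    ContinuousMap.ext fun t => γ.concat_smul g (ι x) _ _
  have hS : ∀ x (j : Fin n), S x (gridPoint n j) = x j := by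
    intro x j
    have hn' : (n : ℝ) - 1 ≠ 0 := by
      have : (2 : ℝ) ≤ n := by exact_mod_cast hn
      linarith
    have hj : (gridPoint n j : ℝ) * ((n : ℝ) - 1) = (j : ℕ) := div_mul_cancel₀ _ hn'
    change γ.concat (ι x) (n - 1) (gridPoint n j * ((n : ℝ) - 1)) = x j
    rw [hj, γ.concat_natCast _ (by omega)]
    exact congrArg x (Fin.ext (min_eq_left (by omega)))
  refine ⟨⟨Quotient.map' S ?_, S.continuous.quotient_map' _⟩, fun y => ?_⟩
  · rintro _ x ⟨g, rfl⟩
    exact ⟨g, (hSG g x).symm⟩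
  · induction y using Quotient.inductionOn' with | _ x =>
    exact congrArg Quotient.mk'' (funext (hS x))

theorem tcTilde_eq_one_of_isAspherical {X : Type*} [TopologicalSpace X] [T2Space X]
    [CWComplex (Set.univ : Set X)] (h : IsAspherical X) (x₀ : X) {n : ℕ} (hn : 2 ≤ n) :
    tcTilde n X x₀ = 1 := by
  have := h.1
  have := CWCell.locallyPathConnectedSpace X
  have hX := CWCell.isSemilocallySimplyConnected X
  have hp := UniversalCover.isQuotientCoveringMap_proj (x₀ := x₀) hX
  have := UniversalCover.t2Space (x₀ := x₀) hX
  have := UniversalCover.simplyConnectedSpace (x₀ := x₀) hX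
  obtain ⟨γ⟩ := EquivariantPathChoice.nonempty_of_isQuotientCoveringMap hp
    (subsingleton_homotopyGroup_of_isCoveringMap hp.isCoveringMap h.2)
  exact secatTilde_eq_one_iff.2 (exists_section_pathEvaluation γ hn)

theorem mainTheorem7 {X : Type*} [TopologicalSpace X] [T2Space X]
    [Topology.CWComplex (Set.univ : Set X)] [PathConnectedSpace X] (x₀ : X) :
    List.TFAE
      [∃ n : ℕ, 2 ≤ n ∧ tcTilde n X x₀ = 1,
        IsAspherical X,
        ∀ n : ℕ, 2 ≤ n → tcTilde n X x₀ = 1] := by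
  have := CWCell.locallyPathConnectedSpace X
  tfae_have 1 → 2 := fun ⟨_, hn, h⟩ =>
    UniversalCover.isAspherical_of_tcTilde_eq_one (CWCell.isSemilocallySimplyConnected X) hn h
  tfae_have 2 → 3 := fun h _ hn => tcTilde_eq_one_of_isAspherical h x₀ hn
  tfae_have 3 → 1 := fun h => ⟨2, le_rfl, h 2 le_rfl⟩
  tfae_finish
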